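/- Let $n\ge 1$, let $X=(X_1,\dots,X_K)\in\mathbb R^{n\times p}$ be a fixed design matrix with blocks $X_k\in\mathbb R^{n\times p_k}$, $\sum_k p_k=p$, and let $B_0\in\mathbb R^{p\times q}$. For $B\in\mathbb R^{p\times q}$ write $B=(B_1^{\mathrm T},\dots,B_K^{\mathrm T})^{\mathrm T}$ with $B_k\in\mathbb R^{p_k\times q}$. Let $\|\cdot\|_F$ denote the Frobenius norm, $\sigma(A,j)$ the $j$-th largest singular value of a matrix $A$ (zero if $A$ is an empty matrix), $r(A)$ its rank, and $\|A\|_*=\sum_j\sigma(A,j)$ its nuclear norm. Let $Y=XB_0+E$, where the entries of the random matrix $E\in\mathbb R^{n\times q}$ are i.i.d. $N(0,\tau^2)$, $\tau\ge 0$. Let $\theta>0$ be arbitrary, $\lambda=(1+\theta)\tau$, and $w_k=\sigma(X_k,1)\{\sqrt q+\sqrt{r(X_k)}\}/n$. The integrative reduced-rank regression (iRRR) estimator is any minimizer $$\widehat B\in\arg\min_{B\in\mathbb R^{p\times q}}\ \frac1{2n}\|Y-XB\|_F^2+\lambda\sum_{k=1}^K w_k\|B_k\|_* .$$ Then there is an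 event of probability at least $1-\sum_{k=1}^K\exp[-\theta^2\{q+r(X_k)\}/2]$ on which, for every such minimizer $\widehat B$ and simultaneously for every $C\in\mathbb R^{p\times q}$ with blocks $C_k\in\mathbb R^{p_k\times q}$, $$\|X\widehat B-XB_0\|_F^2\le\|XC-XB_0\|_F^2+4\lambda\sum_{k=1}^K\sigma(X_k,1)\{\sqrt q+\sqrt{r(X_k)}\}\|C_k\|_* .$$ No condition is imposed on the design matrix $X$. -/

import Mathlib

open MeasureTheory ProbabilityTheory
open scoped NNReal

-- `‖A‖` is the Frobenius norm of a matrix `A`.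
attribute [local instance] Matrix.frobeniusNormedAddCommGroup

noncomputable section

namespace IRRR

/-- The singular values of a real matrix in decreasing order, as those of the linear map it defines
between Euclidean spaces. The index starts at `0`: `singularValue A 0` is the largest one. -/
def singularValue {m n : ℕ} (A : Matrix (Fin m) (Fin n) ℝ) (j : ℕ) : ℝ :=
  (Matrix.toEuclideanLin A).singularValues j

/-- The nuclear norm: the sum of the `min m n` singular values. -/
def nuclearNorm {m n : ℕ} (A : Matrix (Fin m) (Fin n) ℝ) : ℝ :=
  ∑ j ∈ Finset.range (min m n), singularValue A j

/-- The `k`-th column block `X_k` of a design matrix `X = (X_1, …, X_K)`. -/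
def colBlock {n K : ℕ} {p : Fin K → ℕ} (X : Matrix (Fin n) ((k : Fin K) × Fin (p k)) ℝ)
    (k : Fin K) : Matrix (Fin n) (Fin (p k)) ℝ :=
  X.submatrix id fun i => ⟨k, i⟩

/-- The `k`-th row block `B_k` of a coefficient matrix `B = (B_1ᵀ, …, B_Kᵀ)ᵀ`. -/
def rowBlock {K q : ℕ} {p : Fin K → ℕ} (B : Matrix ((k : Fin K) × Fin (p k)) (Fin q) ℝ)
    (k : Fin K) : Matrix (Fin (p k)) (Fin q) ℝ :=
  B.submatrix (fun i => ⟨k, i⟩) id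

/-- The weight `w_k = σ(X_k, 1) {√q + √r(X_k)} / n`. -/
def weight {n K : ℕ} (q : ℕ) {p : Fin K → ℕ} (X : Matrix (Fin n) ((k : Fin K) × Fin (p k)) ℝ)
    (k : Fin K) : ℝ :=
  singularValue (colBlock X k) 0 * (√(q : ℝ) + √((colBlock X k).rank : ℝ)) / n

/-- The composite nuclear norm penalized least squares criterion
`‖Y - X B‖_F² / (2 n) + lam ∑ₖ w_k ‖B_k‖_*`. -/
def criterion {n K q : ℕ} {p : Fin K → ℕ} (X : Matrix (Fin n) ((k : Fin K) × Fin (p k)) ℝ)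
    (Y : Matrix (Fin n) (Fin q) ℝ) (lam : ℝ) (w : Fin K → ℝ)
    (B : Matrix ((k : Fin K) × Fin (p k)) (Fin q) ℝ) : ℝ :=
  1 / (2 * (n : ℝ)) * ‖Y - X * B‖ ^ 2 + lam * ∑ k, w k * nuclearNorm (rowBlock B k)

/-- `Bhat` is an iRRR estimate: a global minimizer of the criterion with the weights above. -/
def IsEstimate {n K q : ℕ} {p : Fin K → ℕ} (X : Matrix (Fin n) ((k : Fin K) × Fin (p k)) ℝ)
    (Y : Matrix (Fin n) (Fin q) ℝ) (lam : ℝ)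
    (Bhat : Matrix ((k : Fin K) × Fin (p k)) (Fin q) ℝ) : Prop :=
  IsMinOn (criterion X Y lam (weight q X)) Set.univ Bhat

end IRRR

end

namespace IRRR

/-! The deterministic half is the basic inequality. Comparing the criterion at `Bhat` and at `C`
leaves the noise terms ⟨E, X Bhat⟩ and ⟨E, X C⟩. If σ(X_kᵀE, 1) ≤ λ σ(X_k, 1){√q + √r(X_k)} for
every k, operator/nuclear duality bounds each by λ times the corresponding penalty. The penalty of
`Bhat` then cancels and that of `C` doubles, whence the factor 4 and the absence of design
conditions (`oracle_inequality_of_noise_le`).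

The probabilistic half bounds σ(XᵀZ, 1) for standard Gaussian Z by σ(X, 1) times the supremum M of
uᵀZv over unit u in the range of X and unit v. The range has dimension r = r(X), and the bound
needed is P(M > √q + √r + t) ≤ exp(-t²/2) with t = θ(√q + √r).

This tail comes from Slepian's inequality alone, without Lipschitz concentration. With γ, g, h
independent and standard normal, compare uᵀZv + γ with ⟨u, g⟩ + ⟨v, h⟩: variances agree, and the
covariances differ by (1 - ⟨u, u'⟩)(1 - ⟨v, v'⟩) ≥ 0. Hence E exp(sM) · exp(s²/2) ≤ E exp(s‖g‖) · E
exp(s‖h‖) ≤ exp(s√r + s²/2) exp(s√q + s²/2). The factor contributed by γ cancels one of the two on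
the right, and Markov at s = t finishes (`chevet_finite`).

Slepian's inequality is proved by interpolating a smooth surrogate of 1{max y < c} whose mixed
second derivatives are nonnegative (`integral_gumbel_le_of_slepian`), then sharpening the surrogate
(`slepian`). -/

/-! ### Gaussian integration by parts -/

theorem hasDerivAt_gaussianPDFReal_standard (x : ℝ) :
    HasDerivAt (gaussianPDFReal 0 1) (-x * gaussianPDFReal 0 1 x) x := by
  have h : HasDerivAt (fun y : ℝ => -(y - 0) ^ 2 / (2 * ((1 : ℝ≥0) : ℝ))) (-x) x := by
    have := (((hasDerivAt_id x).sub_const 0).pow 2).neg.div_const (2 * ((1 : ℝ≥0) : ℝ))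
    convert! this using 1
    simp only [NNReal.coe_one, id]
    ring
  have h2 := h.exp.const_mul (√(2 * Real.pi * ((1 : ℝ≥0) : ℝ)))⁻¹
  rw [gaussianPDFReal_def]
  convert! h2 using 1
  ring

theorem integrable_id_mul_gaussianPDFReal_standard :
    Integrable (fun x => x * gaussianPDFReal 0 1 x) := by
  have h := (integrable_mul_exp_neg_mul_sq (b := 1 / 2) (by norm_num)).const_mul
    (√(2 * Real.pi * ((1 : ℝ≥0) : ℝ)))⁻¹
  refine h.congr (.of_forall fun x => ?_)
  simp only [gaussianPDFReal_def, NNReal.coe_one, sub_zero]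
  rw [show -x ^ 2 / (2 * 1) = -(1 / 2) * x ^ 2 by ring]
  ring

/-- Gaussian integration by parts on the line. -/
theorem integral_id_mul_gaussianReal {f f' : ℝ → ℝ} (hf : ∀ x, HasDerivAt f (f' x) x)
    {C : ℝ} (hC : ∀ x, |f x| ≤ C) (hC' : ∀ x, |f' x| ≤ C) :
    ∫ x, x * f x ∂gaussianReal 0 1 = ∫ x, f' x ∂gaussianReal 0 1 := by
  have hfc : Continuous f := continuous_iff_continuousAt.2 fun x => (hf x).continuousAt
  have hf'm : Measurable f' := by
    have : f' = deriv f := funext fun x => (hf x).deriv.symm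
    rw [this]; exact measurable_deriv f
  have hi1 : Integrable (fun x => f' x * gaussianPDFReal 0 1 x) :=
    (integrable_gaussianPDFReal 0 1).bdd_mul hf'm.aestronglyMeasurable (.of_forall hC')
  have hi2 : Integrable (fun x => f x * (x * gaussianPDFReal 0 1 x)) :=
    integrable_id_mul_gaussianPDFReal_standard.bdd_mul hfc.aestronglyMeasurable (.of_forall hC)
  have hi0 : Integrable (fun x => f x * gaussianPDFReal 0 1 x) :=
    (integrable_gaussianPDFReal 0 1).bdd_mul hfc.aestronglyMeasurable (.of_forall hC)
  have key := integral_eq_zero_of_hasDerivAt_of_integrable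
    (f := fun x => f x * gaussianPDFReal 0 1 x)
    (f' := fun x => f' x * gaussianPDFReal 0 1 x - f x * (x * gaussianPDFReal 0 1 x))
    (fun x => by
      convert! (hf x).mul (hasDerivAt_gaussianPDFReal_standard x) using 1
      ring) (hi1.sub hi2) hi0
  rw [integral_sub hi1 hi2, sub_eq_zero] at key
  rw [integral_gaussianReal_eq_integral_smul one_ne_zero,
    integral_gaussianReal_eq_integral_smul one_ne_zero]
  simp only [smul_eq_mul]
  calc _ = ∫ x, f x * (x * gaussianPDFReal 0 1 x) := by congr 1; ext x; ring
    _ = _ := by rw [← key]; congr 1; ext x; ring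

/-- The standard Gaussian measure on `κ → ℝ`. -/
noncomputable abbrev gauss (κ : Type*) [Fintype κ] : Measure (κ → ℝ) :=
  Measure.pi fun _ => gaussianReal 0 1

/-- Resampling one coordinate independently keeps a product law. This isolates a coordinate for
Fubini without reindexing `κ`. -/
theorem measurePreserving_update_pi {κ : Type*} [Fintype κ] [DecidableEq κ] (k : κ) :
    MeasurePreserving (fun z : ℝ × (κ → ℝ) => Function.update z.2 k z.1)
      ((gaussianReal 0 1).prod (gauss κ)) (gauss κ) := by
  have hm : Measurable (fun z : ℝ × (κ → ℝ) => Function.update z.2 k z.1) := by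
    refine measurable_pi_lambda _ fun j => ?_
    by_cases h : j = k
    · subst h; simpa using measurable_fst
    · simp only [Function.update_of_ne h]; fun_prop
  refine ⟨hm, (Measure.pi_eq fun s hs => ?_).symm⟩
  rw [Measure.map_apply hm (.univ_pi hs)]
  have : (fun z : ℝ × (κ → ℝ) => Function.update z.2 k z.1) ⁻¹' Set.univ.pi s
      = s k ×ˢ Set.univ.pi (Function.update s k Set.univ) := by
    ext ⟨a, x⟩
    simp only [Set.mem_preimage, Set.mem_pi, Set.mem_univ, true_imp_iff, Set.mem_prod]
    constructor
    · intro h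
      refine ⟨by simpa using h k, fun j => ?_⟩
      by_cases hj : j = k
      · subst hj; simp
      · simpa [Function.update_of_ne hj] using h j
    · rintro ⟨h1, h2⟩ j
      by_cases hj : j = k
      · subst hj; simpa using h1
      · simpa [Function.update_of_ne hj] using h2 j
  rw [this, Measure.prod_prod, Measure.pi_pi,
    ← Finset.mul_prod_erase Finset.univ (fun i => gaussianReal 0 1 (s i)) (Finset.mem_univ k)]
  congr 1
  rw [← Finset.mul_prod_erase Finset.univ _ (Finset.mem_univ k)]
  simp only [Function.update_self, measure_univ, one_mul]
  refine Finset.prod_congr rfl fun j hj => ?_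
  rw [Function.update_of_ne (Finset.ne_of_mem_erase hj)]

theorem integrable_eval_gauss {κ : Type*} [Fintype κ] (k : κ) :
    Integrable (fun x : κ → ℝ => x k) (gauss κ) := by
  have h : Integrable (fun s : ℝ => s) (gaussianReal 0 1) :=
    (memLp_id_gaussianReal 1).integrable le_rfl
  exact (measurePreserving_eval (fun _ : κ => gaussianReal 0 1) k).integrable_comp_of_integrable h

theorem integral_gauss_eq_integral_update {κ : Type*} [Fintype κ] [DecidableEq κ] (k : κ)
    {h : (κ → ℝ) → ℝ} (hi : Integrable h (gauss κ)) :
    ∫ x, h x ∂gauss κ = ∫ x, ∫ s, h (Function.update x k s) ∂gaussianReal 0 1 ∂gauss κ := by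
  have hmp := measurePreserving_update_pi k
  have := integral_prod_symm _ (hmp.integrable_comp_of_integrable hi)
  simp only [Function.comp_apply] at this
  rw [← this, ← integral_map (f := h) hmp.measurable.aemeasurable (by rw [hmp.map_eq]; exact hi.1),
    hmp.map_eq]

/-- Gaussian integration by parts in one coordinate of `κ → ℝ`. -/
theorem integral_eval_mul_gauss {κ : Type*} [Fintype κ] [DecidableEq κ] (k : κ)
    {f f' : (κ → ℝ) → ℝ}
    (hf : ∀ x s, HasDerivAt (fun s => f (Function.update x k s)) (f' (Function.update x k s)) s)
    (hfc : Continuous f) (hfc' : Continuous f')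
    {C : ℝ} (hC : ∀ x, |f x| ≤ C) (hC' : ∀ x, |f' x| ≤ C) :
    ∫ x, x k * f x ∂gauss κ = ∫ x, f' x ∂gauss κ := by
  have hi1 : Integrable (fun x => x k * f x) (gauss κ) :=
    (integrable_eval_gauss k).mul_bdd (c := C) hfc.aestronglyMeasurable (.of_forall hC)
  have hi2 : Integrable f' (gauss κ) :=
    Integrable.of_bound hfc'.aestronglyMeasurable C (.of_forall hC')
  rw [integral_gauss_eq_integral_update k hi1, integral_gauss_eq_integral_update k hi2]
  congr 1
  ext x
  simp only [Function.update_self]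
  exact integral_id_mul_gaussianReal (hf x) (fun _ => hC _) (fun _ => hC' _)

/-! ### A smooth surrogate for the maximum and its interpolation formula -/

section Gumbel

variable {ι : Type*} [Fintype ι]

/-- A smooth surrogate for the indicator of `∀ i, y i < c`: the joint distribution function of
independent Gumbel variables with scale `β⁻¹`, evaluated at `c - y`. -/
noncomputable def gumbel (β c : ℝ) (y : ι → ℝ) : ℝ :=
  Real.exp (-∑ i, Real.exp (β * (y i - c)))

theorem gumbel_nonneg (β c : ℝ) (y : ι → ℝ) : 0 ≤ gumbel β c y := (Real.exp_pos _).le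

theorem gumbel_le_one (β c : ℝ) (y : ι → ℝ) : gumbel β c y ≤ 1 := by
  rw [gumbel, Real.exp_le_one_iff]
  have : 0 ≤ ∑ i, Real.exp (β * (y i - c)) := Finset.sum_nonneg fun i _ => (Real.exp_pos _).le
  linarith

theorem exp_le_sum_exp (β c : ℝ) (y : ι → ℝ) (i : ι) :
    Real.exp (β * (y i - c)) ≤ ∑ i, Real.exp (β * (y i - c)) :=
  Finset.single_le_sum (f := fun i => Real.exp (β * (y i - c))) (fun _ _ => (Real.exp_pos _).le)
    (Finset.mem_univ i)

/-- With S the sum of the exponentials this is S exp(-S) ≤ 1; the next bound is S² exp(-S) ≤ 2. They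
make the derivatives of the surrogate bounded, which justifies integration by parts and
differentiation under the integral. -/
theorem exp_mul_gumbel_le (β c : ℝ) (y : ι → ℝ) (i : ι) :
    Real.exp (β * (y i - c)) * gumbel β c y ≤ 1 := by
  have h := exp_le_sum_exp β c y i
  have h2 := Real.add_one_le_exp (∑ i, Real.exp (β * (y i - c)))
  rw [gumbel, Real.exp_neg, ← div_eq_mul_inv, div_le_one (Real.exp_pos _)]
  linarith

theorem exp_mul_exp_mul_gumbel_le (β c : ℝ) (y : ι → ℝ) (i j : ι) :
    Real.exp (β * (y i - c)) * Real.exp (β * (y j - c)) * gumbel β c y ≤ 2 := by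
  have hi := exp_le_sum_exp β c y i
  have hj := exp_le_sum_exp β c y j
  have h0 : 0 ≤ ∑ i, Real.exp (β * (y i - c)) := Finset.sum_nonneg fun i _ => (Real.exp_pos _).le
  have h2 := Real.quadratic_le_exp_of_nonneg h0
  have h3 := mul_le_mul hi hj (Real.exp_pos _).le h0
  rw [gumbel, Real.exp_neg, ← div_eq_mul_inv, div_le_iff₀ (Real.exp_pos _)]
  nlinarith

@[fun_prop]
theorem continuous_gumbel (β c : ℝ) : Continuous (gumbel β c : (ι → ℝ) → ℝ) := by
  unfold gumbel; fun_prop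

theorem hasDerivAt_gumbel_comp {β c : ℝ} {y : ℝ → ι → ℝ} {y' : ι → ℝ} {s : ℝ}
    (hy : ∀ i, HasDerivAt (fun s => y s i) (y' i) s) :
    HasDerivAt (fun s => gumbel β c (y s))
      (-β * ∑ i, y' i * (Real.exp (β * (y s i - c)) * gumbel β c (y s))) s := by
  have h : HasDerivAt (fun s => -∑ i, Real.exp (β * (y s i - c)))
      (-∑ i, Real.exp (β * (y s i - c)) * (β * y' i)) s :=
    (HasDerivAt.fun_sum fun i _ => (((hy i).sub_const c).const_mul β).exp).neg
  convert! h.exp using 1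
  simp only [gumbel, Finset.mul_sum, mul_neg, ← Finset.sum_neg_distrib]
  refine Finset.sum_congr rfl fun i _ => ?_
  ring

theorem hasDerivAt_exp_mul_gumbel_comp {β c : ℝ} {y : ℝ → ι → ℝ} {y' : ι → ℝ} {s : ℝ}
    (hy : ∀ i, HasDerivAt (fun s => y s i) (y' i) s) (i : ι) :
    HasDerivAt (fun s => Real.exp (β * (y s i - c)) * gumbel β c (y s))
      (β * (y' i * (Real.exp (β * (y s i - c)) * gumbel β c (y s))) - β * ∑ j, y' j *
        (Real.exp (β * (y s i - c)) * Real.exp (β * (y s j - c)) * gumbel β c (y s))) s := by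
  have h := (((hy i).sub_const c).const_mul β).exp.mul (hasDerivAt_gumbel_comp (β := β) (c := c) hy)
  convert! h using 1
  simp only [Finset.mul_sum, sub_eq_add_neg, ← Finset.sum_neg_distrib]
  congr 1
  · ring
  · refine Finset.sum_congr rfl fun i _ => ?_
    ring

variable {κ : Type*} [Fintype κ]

theorem hasDerivAt_dotProduct_update [DecidableEq κ] (a x : κ → ℝ) (k : κ) (s : ℝ) :
    HasDerivAt (fun s => a ⬝ᵥ Function.update x k s) (a k) s := by
  have h : HasDerivAt (fun s => ∑ l, a l * Function.update x k s l)
      (∑ l, a l * (Pi.single k (1 : ℝ) : κ → ℝ) l) s :=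
    HasDerivAt.fun_sum fun l _ => ((hasDerivAt_pi.1 (hasDerivAt_update x k s)) l).const_mul _
  simpa [dotProduct, Pi.single_apply] using h

theorem integrable_exp_mul_gumbel (β c : ℝ) (a : ι → κ → ℝ) (i : ι) :
    Integrable (fun x => Real.exp (β * (a i ⬝ᵥ x - c)) * gumbel β c fun j => a j ⬝ᵥ x)
      (gauss κ) := by
  refine Integrable.of_bound (Continuous.aestronglyMeasurable (by fun_prop)) 1
    (.of_forall fun x => ?_)
  rw [Real.norm_of_nonneg (mul_nonneg (Real.exp_pos _).le (gumbel_nonneg _ _ _))]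
  exact exp_mul_gumbel_le β c (fun j => a j ⬝ᵥ x) i

theorem integrable_exp_mul_exp_mul_gumbel (β c : ℝ) (a : ι → κ → ℝ) (i j : ι) :
    Integrable (fun x => Real.exp (β * (a i ⬝ᵥ x - c)) * Real.exp (β * (a j ⬝ᵥ x - c)) *
      gumbel β c fun j => a j ⬝ᵥ x) (gauss κ) := by
  refine Integrable.of_bound (Continuous.aestronglyMeasurable (by fun_prop)) 2
    (.of_forall fun x => ?_)
  rw [Real.norm_of_nonneg (mul_nonneg (by positivity) (gumbel_nonneg _ _ _))]
  exact exp_mul_exp_mul_gumbel_le β c (fun j => a j ⬝ᵥ x) i j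

theorem integrable_dotProduct_mul_exp_mul_gumbel (β c : ℝ) (a : ι → κ → ℝ) (i : ι) (h : κ → ℝ) :
    Integrable (fun x => (h ⬝ᵥ x) *
      (Real.exp (β * (a i ⬝ᵥ x - c)) * gumbel β c fun j => a j ⬝ᵥ x)) (gauss κ) := by
  have h1 : Integrable (fun x : κ → ℝ => h ⬝ᵥ x) (gauss κ) :=
    integrable_finsetSum _ fun k _ => (integrable_eval_gauss k).const_mul _
  refine h1.mul_bdd (c := 1) (Continuous.aestronglyMeasurable (by fun_prop)) (.of_forall fun x => ?_)
  rw [Real.norm_of_nonneg (mul_nonneg (Real.exp_pos _).le (gumbel_nonneg _ _ _))]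
  exact exp_mul_gumbel_le β c (fun j => a j ⬝ᵥ x) i

/-- Integration by parts against a linear form, for the partial derivatives of `gumbel`. -/
theorem integral_dotProduct_mul_exp_mul_gumbel (β c : ℝ) (a : ι → κ → ℝ) (i : ι) (h : κ → ℝ) :
    ∫ x, (h ⬝ᵥ x) * (Real.exp (β * (a i ⬝ᵥ x - c)) * gumbel β c fun j => a j ⬝ᵥ x) ∂gauss κ =
      β * ((h ⬝ᵥ a i) *
        ∫ x, Real.exp (β * (a i ⬝ᵥ x - c)) * gumbel β c (fun j => a j ⬝ᵥ x) ∂gauss κ) -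
      β * ∑ j, (h ⬝ᵥ a j) * ∫ x, Real.exp (β * (a i ⬝ᵥ x - c)) * Real.exp (β * (a j ⬝ᵥ x - c)) *
        gumbel β c (fun j => a j ⬝ᵥ x) ∂gauss κ := by
  classical
  have hcoord (k : κ) : ∫ x, x k *
      (Real.exp (β * (a i ⬝ᵥ x - c)) * gumbel β c fun j => a j ⬝ᵥ x) ∂gauss κ =
      β * (a i k *
        ∫ x, Real.exp (β * (a i ⬝ᵥ x - c)) * gumbel β c (fun j => a j ⬝ᵥ x) ∂gauss κ) -
      β * ∑ j, a j k * ∫ x, Real.exp (β * (a i ⬝ᵥ x - c)) * Real.exp (β * (a j ⬝ᵥ x - c)) *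
        gumbel β c (fun j => a j ⬝ᵥ x) ∂gauss κ := by
    -- One constant must bound both the function (by 1) and its derivative (by the bracket), so the
    -- two bounds are added.
    rw [integral_eval_mul_gauss k (C := 1 + (|β| * |a i k| + |β| * ∑ j, |a j k| * 2))
      (f' := fun x => β * (a i k * (Real.exp (β * (a i ⬝ᵥ x - c)) * gumbel β c fun j => a j ⬝ᵥ x)) -
        β * ∑ j, a j k * (Real.exp (β * (a i ⬝ᵥ x - c)) * Real.exp (β * (a j ⬝ᵥ x - c)) *
        gumbel β c fun j => a j ⬝ᵥ x))]
    · rw [integral_sub, integral_const_mul, integral_const_mul, integral_const_mul,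
        integral_finsetSum]
      · simp_rw [integral_const_mul]
      · exact fun j _ => (integrable_exp_mul_exp_mul_gumbel β c a i j).const_mul _
      · exact ((integrable_exp_mul_gumbel β c a i).const_mul _).const_mul _
      · exact (integrable_finsetSum _ fun j _ =>
          (integrable_exp_mul_exp_mul_gumbel β c a i j).const_mul _).const_mul _
    · exact fun x s => hasDerivAt_exp_mul_gumbel_comp
        (fun j => hasDerivAt_dotProduct_update (a j) x k s) i
    · fun_prop
    · fun_prop
    · intro x
      rw [abs_of_nonneg (mul_nonneg (Real.exp_pos _).le (gumbel_nonneg _ _ _))]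
      have := exp_mul_gumbel_le β c (fun j => a j ⬝ᵥ x) i
      have : 0 ≤ |β| * |a i k| + |β| * ∑ j, |a j k| * 2 := by positivity
      linarith
    · intro x
      refine (abs_sub _ _).trans ?_
      have h1 : |β * (a i k * (Real.exp (β * (a i ⬝ᵥ x - c)) * gumbel β c fun j => a j ⬝ᵥ x))| ≤
          |β| * |a i k| := by
        rw [abs_mul, abs_mul,
          abs_of_nonneg (mul_nonneg (Real.exp_pos _).le (gumbel_nonneg _ _ _))]
        have := exp_mul_gumbel_le β c (fun j => a j ⬝ᵥ x) i
        exact mul_le_mul_of_nonneg_left (mul_le_of_le_one_right (abs_nonneg _) this) (abs_nonneg _)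
      have h2 : |β * ∑ j, a j k * (Real.exp (β * (a i ⬝ᵥ x - c)) * Real.exp (β * (a j ⬝ᵥ x - c)) *
          gumbel β c fun j => a j ⬝ᵥ x)| ≤ |β| * ∑ j, |a j k| * 2 := by
        rw [abs_mul]
        refine mul_le_mul_of_nonneg_left ((Finset.abs_sum_le_sum_abs _ _).trans
          (Finset.sum_le_sum fun j _ => ?_)) (abs_nonneg _)
        rw [abs_mul, abs_of_nonneg (a := _ * gumbel _ _ _)
          (mul_nonneg (by positivity) (gumbel_nonneg _ _ _))]
        exact mul_le_mul_of_nonneg_left (exp_mul_exp_mul_gumbel_le β c (fun j => a j ⬝ᵥ x) i j)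
          (abs_nonneg _)
      linarith
  calc _ = ∑ k, h k * ∫ x, x k *
      (Real.exp (β * (a i ⬝ᵥ x - c)) * gumbel β c fun j => a j ⬝ᵥ x) ∂gauss κ := by
        simp_rw [← integral_const_mul]
        rw [← integral_finsetSum]
        · simp only [dotProduct, Finset.sum_mul, mul_assoc]
        · intro k _
          have := integrable_dotProduct_mul_exp_mul_gumbel β c a i (Pi.single k 1)
          simp only [single_one_dotProduct] at this
          exact this.const_mul _
    _ = _ := by
        simp_rw [hcoord, mul_sub, Finset.sum_sub_distrib]
        congr 1
        · simp only [dotProduct, Finset.sum_mul, Finset.mul_sum]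
          refine Finset.sum_congr rfl fun k _ => ?_
          ring
        · simp only [dotProduct, Finset.sum_mul, Finset.mul_sum]
          rw [Finset.sum_comm]
          refine Finset.sum_congr rfl fun j _ => Finset.sum_congr rfl fun k _ => ?_
          ring

/-- The Gaussian interpolation formula for `gumbel`. -/
theorem hasDerivAt_integral_gumbel_path (β c : ℝ) {a a' : ℝ → ι → κ → ℝ}
    (ha : ∀ t i k, HasDerivAt (fun t => a t i k) (a' t i k) t)
    {D : ℝ} (hD : ∀ t i k, |a' t i k| ≤ D) (t : ℝ)
    (h0 : ∀ i, a' t i ⬝ᵥ a t i = 0) :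
    HasDerivAt (fun t => ∫ x, gumbel β c (fun i => a t i ⬝ᵥ x) ∂gauss κ)
      (β ^ 2 * ∑ i, ∑ j, (a' t i ⬝ᵥ a t j) *
        ∫ x, Real.exp (β * (a t i ⬝ᵥ x - c)) * Real.exp (β * (a t j ⬝ᵥ x - c)) *
          gumbel β c (fun j => a t j ⬝ᵥ x) ∂gauss κ) t := by
  have hdot (x : κ → ℝ) (s : ℝ) (i : ι) :
      HasDerivAt (fun s => a s i ⬝ᵥ x) (a' s i ⬝ᵥ x) s :=
    HasDerivAt.fun_sum fun k _ => (ha s i k).mul_const (x k)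
  have key := hasDerivAt_integral_of_dominated_loc_of_deriv_le (μ := gauss κ) (x₀ := t)
    (F := fun t x => gumbel β c (fun i => a t i ⬝ᵥ x))
    (F' := fun t x => -β * ∑ i, (a' t i ⬝ᵥ x) *
      (Real.exp (β * (a t i ⬝ᵥ x - c)) * gumbel β c (fun j => a t j ⬝ᵥ x)))
    (bound := fun x => |β| * ∑ i : ι, ∑ k, D * |x k|) Filter.univ_mem
    (.of_forall fun s => Continuous.aestronglyMeasurable (by fun_prop))
    (Integrable.of_bound (Continuous.aestronglyMeasurable (by fun_prop)) 1 (.of_forall fun x => by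
      rw [Real.norm_of_nonneg (gumbel_nonneg _ _ _)]; exact gumbel_le_one _ _ _))
    (Continuous.aestronglyMeasurable (by fun_prop))
    (.of_forall fun x s _ => by
      rw [Real.norm_eq_abs, abs_mul, abs_neg]
      refine mul_le_mul_of_nonneg_left ((Finset.abs_sum_le_sum_abs _ _).trans
        (Finset.sum_le_sum fun i _ => ?_)) (abs_nonneg _)
      rw [abs_mul, abs_of_nonneg (mul_nonneg (Real.exp_pos _).le (gumbel_nonneg _ _ _))]
      refine (mul_le_of_le_one_right (abs_nonneg _)
        (exp_mul_gumbel_le β c (fun j => a s j ⬝ᵥ x) i)).trans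
        ((Finset.abs_sum_le_sum_abs _ _).trans (Finset.sum_le_sum fun k _ => ?_))
      rw [abs_mul]
      exact mul_le_mul_of_nonneg_right (hD s i k) (abs_nonneg _))
    ((integrable_finsetSum _ fun i _ => integrable_finsetSum _ fun k _ =>
      (integrable_eval_gauss k).abs.const_mul _).const_mul _)
    (.of_forall fun x s _ => hasDerivAt_gumbel_comp (hdot x s))
  convert! key.2 using 1
  rw [integral_const_mul, integral_finsetSum _ fun i _ =>
    integrable_dotProduct_mul_exp_mul_gumbel β c (a t) i (a' t i)]
  -- The terms with a single exponential carry `a' t i ⬝ᵥ a t i`, half the derivative of the i-th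
  -- variance, and vanish by `h0`. Only terms with nonnegative integrals remain.
  simp_rw [integral_dotProduct_mul_exp_mul_gumbel, h0, zero_mul, mul_zero, zero_sub]
  rw [Finset.sum_neg_distrib, ← Finset.mul_sum]
  ring

end Gumbel

/-! ### Slepian's inequality -/

/-- Slepian's comparison inequality, in a smoothed form. -/
theorem integral_gumbel_le_of_slepian {ι κ₁ κ₂ : Type*} [Fintype ι] [Fintype κ₁] [Fintype κ₂]
    (β c : ℝ) (a : ι → κ₁ → ℝ) (b : ι → κ₂ → ℝ)
    (hdiag : ∀ i, a i ⬝ᵥ a i = b i ⬝ᵥ b i) (hle : ∀ i j, b i ⬝ᵥ b j ≤ a i ⬝ᵥ a j) :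
    ∫ y, gumbel β c (fun i => b i ⬝ᵥ y) ∂gauss κ₂ ≤
      ∫ x, gumbel β c (fun i => a i ⬝ᵥ x) ∂gauss κ₁ := by
  -- Rotating between independent copies keeps variances constant when those of `a` and `b` agree.
  -- Off-diagonal covariances then move monotonically from those of `a` to those of `b`.
  let e : ℝ → ι → κ₁ ⊕ κ₂ → ℝ :=
    fun t i => Sum.elim (fun k => Real.cos t * a i k) (fun k => Real.sin t * b i k)
  let e' : ℝ → ι → κ₁ ⊕ κ₂ → ℝ :=
    fun t i => Sum.elim (fun k => -Real.sin t * a i k) (fun k => Real.cos t * b i k)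
  have hdot (t : ℝ) (i j : ι) : e' t i ⬝ᵥ e t j =
      Real.sin t * Real.cos t * (b i ⬝ᵥ b j - a i ⬝ᵥ a j) := by
    simp only [e, e', dotProduct, Fintype.sum_sum_type, Sum.elim_inl, Sum.elim_inr, mul_sub,
      Finset.mul_sum]
    rw [add_comm, sub_eq_add_neg, ← Finset.sum_neg_distrib]
    congr 1 <;> refine Finset.sum_congr rfl fun k _ => ?_ <;> ring
  have hderiv (t : ℝ) := hasDerivAt_integral_gumbel_path β c (a := e) (a' := e')
    (D := ∑ i, ∑ k, |a i k| + ∑ i, ∑ k, |b i k|)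
    (fun t i k => by
      rcases k with k | k
      · exact (Real.hasDerivAt_cos t).mul_const _
      · exact (Real.hasDerivAt_sin t).mul_const _)
    (fun t i k => by
      have ha : 0 ≤ ∑ i, ∑ k, |a i k| := by positivity
      have hb : 0 ≤ ∑ i, ∑ k, |b i k| := by positivity
      rcases k with k | k
      · simp only [e', Sum.elim_inl, abs_mul, abs_neg]
        have := mul_le_of_le_one_left (abs_nonneg (a i k)) (Real.abs_sin_le_one t)
        have := (Finset.single_le_sum (f := fun k => |a i k|) (fun _ _ => abs_nonneg _)
          (Finset.mem_univ k)).trans (Finset.single_le_sum (f := fun i => ∑ k, |a i k|)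
            (fun _ _ => by positivity) (Finset.mem_univ i))
        linarith
      · simp only [e', Sum.elim_inr, abs_mul]
        have := mul_le_of_le_one_left (abs_nonneg (b i k)) (Real.abs_cos_le_one t)
        have := (Finset.single_le_sum (f := fun k => |b i k|) (fun _ _ => abs_nonneg _)
          (Finset.mem_univ k)).trans (Finset.single_le_sum (f := fun i => ∑ k, |b i k|)
            (fun _ _ => by positivity) (Finset.mem_univ i))
        linarith)
    t (fun i => by rw [hdot, hdiag]; ring)
  have hanti : AntitoneOn (fun t => ∫ x, gumbel β c (fun i => e t i ⬝ᵥ x) ∂gauss (κ₁ ⊕ κ₂))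
      (Set.Icc 0 (Real.pi / 2)) := by
    refine antitoneOn_of_deriv_nonpos (convex_Icc _ _)
      (fun t _ => (hderiv t).continuousAt.continuousWithinAt)
      (fun t _ => (hderiv t).differentiableAt.differentiableWithinAt) fun t ht => ?_
    rw [interior_Icc] at ht
    rw [(hderiv t).deriv]
    refine mul_nonpos_of_nonneg_of_nonpos (sq_nonneg β)
      (Finset.sum_nonpos fun i _ => Finset.sum_nonpos fun j _ => ?_)
    refine mul_nonpos_of_nonpos_of_nonneg ?_
      (integral_nonneg fun x => mul_nonneg (by positivity) (gumbel_nonneg _ _ _))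
    rw [hdot]
    have hs := Real.sin_nonneg_of_nonneg_of_le_pi ht.1.le (by linarith [ht.2, Real.pi_pos])
    have hc := Real.cos_nonneg_of_neg_pi_div_two_le_of_le (x := t) (by linarith [ht.1, Real.pi_pos])
      ht.2.le
    exact mul_nonpos_of_nonneg_of_nonpos (mul_nonneg hs hc) (by linarith [hle i j])
  have hpi := Real.pi_pos
  have h := hanti (Set.left_mem_Icc.2 (by positivity)) (Set.right_mem_Icc.2 (by positivity))
    (by positivity)
  have hmp := measurePreserving_sumPiEquivProdPi (fun _ : κ₁ ⊕ κ₂ => gaussianReal 0 1)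
  have h1 : MeasurePreserving (fun x : κ₁ ⊕ κ₂ → ℝ => x ∘ Sum.inl) (gauss (κ₁ ⊕ κ₂)) (gauss κ₁) :=
    measurePreserving_fst.comp hmp
  have h2 : MeasurePreserving (fun x : κ₁ ⊕ κ₂ → ℝ => x ∘ Sum.inr) (gauss (κ₁ ⊕ κ₂)) (gauss κ₂) :=
    measurePreserving_snd.comp hmp
  rw [← h1.map_eq, ← h2.map_eq,
    integral_map h1.measurable.aemeasurable (Continuous.aestronglyMeasurable (by fun_prop)),
    integral_map h2.measurable.aemeasurable (Continuous.aestronglyMeasurable (by fun_prop))]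
  have e0 (i : ι) (x : κ₁ ⊕ κ₂ → ℝ) : e 0 i ⬝ᵥ x = a i ⬝ᵥ (x ∘ Sum.inl) := by
    simp [e, dotProduct]
  have e1 (i : ι) (x : κ₁ ⊕ κ₂ → ℝ) : e (Real.pi / 2) i ⬝ᵥ x = b i ⬝ᵥ (x ∘ Sum.inr) := by
    simp [e, dotProduct]
  simpa only [e0, e1] using h

theorem integrable_gumbel {ι κ : Type*} [Fintype ι] [Fintype κ] (β c : ℝ) (a : ι → κ → ℝ) :
    Integrable (fun x => gumbel β c fun i => a i ⬝ᵥ x) (gauss κ) :=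
  Integrable.of_bound (Continuous.aestronglyMeasurable (by fun_prop)) 1 (.of_forall fun x => by
    rw [Real.norm_of_nonneg (gumbel_nonneg _ _ _)]; exact gumbel_le_one _ _ _)

/-- Slepian's comparison inequality for the maxima of two finite Gaussian families. -/
theorem slepian {ι κ₁ κ₂ : Type*} [Fintype ι] [Fintype κ₁] [Fintype κ₂]
    (a : ι → κ₁ → ℝ) (b : ι → κ₂ → ℝ)
    (hdiag : ∀ i, a i ⬝ᵥ a i = b i ⬝ᵥ b i) (hle : ∀ i j, b i ⬝ᵥ b j ≤ a i ⬝ᵥ a j)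
    {c₁ c₂ : ℝ} (hc : c₁ < c₂) :
    (gauss κ₁).real {x | ∃ i, c₂ ≤ a i ⬝ᵥ x} ≤ (gauss κ₂).real {y | ∃ i, c₁ < b i ⬝ᵥ y} := by
  set A : Set (κ₁ → ℝ) := {x | ∃ i, c₂ ≤ a i ⬝ᵥ x}
  set B : Set (κ₂ → ℝ) := {y | ∃ i, c₁ < b i ⬝ᵥ y}
  have hA : MeasurableSet A := by
    simp only [A, Set.ofPred_exists]
    exact .iUnion fun i => measurableSet_le measurable_const (Continuous.measurable (by fun_prop))
  have hB : MeasurableSet B := by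
    simp only [B, Set.ofPred_exists]
    exact .iUnion fun i => measurableSet_lt measurable_const (Continuous.measurable (by fun_prop))
  set c := (c₁ + c₂) / 2 with hcdef
  set δ := (c₂ - c₁) / 2 with hδdef
  have hδ : 0 < δ := by rw [hδdef]; linarith
  -- The threshold c is the midpoint of the gap. Off `B` every exponent is at most -βδ, so the
  -- surrogate is near 1; on `A` some exponent is at least βδ, so it is near 0. Both errors vanish
  -- as β → ∞.
  have key (β : ℝ) (hβ : 0 ≤ β) :
      (1 - (gauss κ₂).real B) * Real.exp (-(Fintype.card ι * Real.exp (-(β * δ)))) ≤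
        1 - (gauss κ₁).real A + Real.exp (-Real.exp (β * δ)) := by
    rw [← probReal_compl_eq_one_sub hA, ← probReal_compl_eq_one_sub hB]
    have hl : (gauss κ₂).real Bᶜ * Real.exp (-(Fintype.card ι * Real.exp (-(β * δ)))) ≤
        ∫ y, gumbel β c (fun i => b i ⬝ᵥ y) ∂gauss κ₂ := by
      rw [← smul_eq_mul, ← integral_indicator_const _ hB.compl]
      refine integral_mono ((integrable_const _).indicator hB.compl) (integrable_gumbel β c b) fun y => ?_
      by_cases hy : y ∈ Bᶜ
      · rw [Set.indicator_of_mem hy, gumbel, Real.exp_le_exp, neg_le_neg_iff]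
        have : ∀ i ∈ Finset.univ, Real.exp (β * (b i ⬝ᵥ y - c)) ≤ Real.exp (-(β * δ)) := by
          intro i _
          have hi : b i ⬝ᵥ y ≤ c₁ := by
            by_contra hcon
            exact hy ⟨i, not_le.1 hcon⟩
          rw [Real.exp_le_exp]
          have : b i ⬝ᵥ y - c ≤ -δ := by rw [hcdef, hδdef]; linarith
          nlinarith
        simpa using Finset.sum_le_card_nsmul _ _ _ this
      · rw [Set.indicator_of_notMem hy]
        exact gumbel_nonneg _ _ _
    have hr : ∫ x, gumbel β c (fun i => a i ⬝ᵥ x) ∂gauss κ₁ ≤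
        (gauss κ₁).real Aᶜ + Real.exp (-Real.exp (β * δ)) := by
      have hi1 : Integrable (Set.indicator Aᶜ fun _ => (1 : ℝ)) (gauss κ₁) :=
        (integrable_const _).indicator hA.compl
      calc _ ≤ ∫ x, (Set.indicator Aᶜ (fun _ => (1 : ℝ)) x + Real.exp (-Real.exp (β * δ)))
            ∂gauss κ₁ := by
            refine integral_mono (integrable_gumbel β c a) (hi1.add (integrable_const _)) fun x => ?_
            by_cases hx : x ∈ A
            · obtain ⟨i, hi⟩ := id hx
              rw [Set.indicator_of_notMem (by simpa using hx), zero_add, gumbel, Real.exp_le_exp,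
                neg_le_neg_iff]
              refine le_trans ?_ (exp_le_sum_exp β c (fun i => a i ⬝ᵥ x) i)
              rw [Real.exp_le_exp]
              have : δ ≤ a i ⬝ᵥ x - c := by rw [hcdef, hδdef]; linarith
              exact mul_le_mul_of_nonneg_left this hβ
            · rw [Set.indicator_of_mem (by simpa using hx)]
              have := gumbel_le_one β c fun i => a i ⬝ᵥ x
              have := Real.exp_pos (-Real.exp (β * δ))
              linarith
        _ = _ := by
            rw [integral_add hi1 (integrable_const _), integral_indicator_const _ hA.compl]
            simp
    exact hl.trans ((integral_gumbel_le_of_slepian β c a b hdiag hle).trans hr)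
  have hlin : Filter.Tendsto (fun β : ℝ => β * δ) Filter.atTop Filter.atTop :=
    Filter.tendsto_id.atTop_mul_const hδ
  have hlim1 : Filter.Tendsto (fun β : ℝ => (1 - (gauss κ₂).real B) *
      Real.exp (-(Fintype.card ι * Real.exp (-(β * δ))))) Filter.atTop
      (nhds ((1 - (gauss κ₂).real B) * Real.exp (-(Fintype.card ι * 0)))) :=
    ((Real.continuous_exp.tendsto _).comp
      (((Real.tendsto_exp_neg_atTop_nhds_zero.comp hlin).const_mul _).neg)).const_mul _
  have hlim2 : Filter.Tendsto (fun β : ℝ => 1 - (gauss κ₁).real A + Real.exp (-Real.exp (β * δ)))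
      Filter.atTop (nhds (1 - (gauss κ₁).real A + 0)) :=
    (Real.tendsto_exp_neg_atTop_nhds_zero.comp (Real.tendsto_exp_atTop.comp hlin)).const_add _
  have := le_of_tendsto_of_tendsto hlim1 hlim2
    ((Filter.eventually_ge_atTop 0).mono fun β hβ => key β hβ)
  simp only [mul_zero, neg_zero, Real.exp_zero, mul_one, add_zero] at this
  linarith

/-! ### Exponential moments and Chevet's inequality -/

/-- Exponential moments are monotone under comparison of tails. -/
theorem lintegral_exp_le_of_tail_le {α α' : Type*} [MeasurableSpace α] [MeasurableSpace α']
    {μ : Measure α} {ν : Measure α'} {f : α → ℝ} {g : α' → ℝ} (hf : Measurable f)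
    (hg : Measurable g) (h : ∀ c₁ c₂, c₁ < c₂ → μ {x | c₂ ≤ f x} ≤ ν {y | c₁ < g y})
    {s δ : ℝ} (hs : 0 < s) (hδ : 0 < δ) :
    ∫⁻ x, ENNReal.ofReal (Real.exp (s * f x)) ∂μ ≤
      ∫⁻ y, ENNReal.ofReal (Real.exp (s * (g y + δ))) ∂ν := by
  rw [lintegral_eq_lintegral_meas_le μ (.of_forall fun x => (Real.exp_pos _).le)
      (by fun_prop), lintegral_eq_lintegral_meas_lt ν (.of_forall fun x => (Real.exp_pos _).le)
      (by fun_prop)]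
  refine setLIntegral_mono' measurableSet_Ioi fun t (ht : 0 < t) => ?_
  -- In the layer-cake formula, level t of the exponential is level log t / s of `f`. The shift δ
  -- supplies the strict gap that the tail comparison demands.
  convert! h (Real.log t / s - δ) (Real.log t / s) (by linarith) using 2
  · ext x
    simp only [Set.mem_ofPred_eq]
    rw [← Real.log_le_iff_le_exp ht, div_le_iff₀' hs]
  · ext x
    simp only [Set.mem_ofPred_eq]
    rw [← Real.log_lt_iff_lt_exp ht, sub_lt_iff_lt_add, div_lt_iff₀' hs]

theorem integral_exp_mul_sq_gaussianReal {a : ℝ} (ha : a < 1 / 2) :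
    Integrable (fun x => Real.exp (a * x ^ 2)) (gaussianReal 0 1) ∧
      ∫ x, Real.exp (a * x ^ 2) ∂gaussianReal 0 1 = √(1 / (1 - 2 * a)) := by
  have hfun : (fun x => gaussianPDFReal 0 1 x * Real.exp (a * x ^ 2)) =
      fun x => (√(2 * Real.pi))⁻¹ * Real.exp (-(1 / 2 - a) * x ^ 2) := by
    ext x
    rw [gaussianPDFReal_def]
    simp only [NNReal.coe_one, mul_one, sub_zero]
    rw [mul_assoc, ← Real.exp_add]
    congr 2
    ring
  have hi := integrable_exp_neg_mul_sq (b := 1 / 2 - a) (by linarith)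
  constructor
  · rw [gaussianReal_of_var_ne_zero _ one_ne_zero,
      integrable_withDensity_iff_integrable_smul₀' (measurable_gaussianPDF 0 1).aemeasurable
        (.of_forall fun _ => gaussianPDF_lt_top)]
    simp only [toReal_gaussianPDF, smul_eq_mul]
    rw [hfun]
    exact hi.const_mul _
  · rw [integral_gaussianReal_eq_integral_smul one_ne_zero]
    simp only [smul_eq_mul]
    rw [hfun, integral_const_mul, integral_gaussian, ← Real.sqrt_inv,
      ← Real.sqrt_mul (by positivity)]
    congr 1
    have : 1 - 2 * a ≠ 0 := by linarith
    have : (1 / 2 - a) ≠ 0 := by linarith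
    have := Real.pi_ne_zero
    field_simp

/-- Exponential moments of the Euclidean norm of a standard Gaussian vector. -/
theorem lintegral_exp_norm_gauss_le (κ : Type*) [Fintype κ] {s : ℝ} (hs : 0 < s) :
    ∫⁻ y, ENNReal.ofReal (Real.exp (s * √(y ⬝ᵥ y))) ∂gauss κ ≤
      ENNReal.ofReal (Real.exp (s * √(Fintype.card κ : ℝ) + s ^ 2 / 2)) := by
  rcases isEmpty_or_nonempty κ with hκ | hκ
  · simp only [dotProduct, Finset.univ_eq_empty, Finset.sum_empty, Real.sqrt_zero, mul_zero,
      Real.exp_zero, lintegral_const, measure_univ, mul_one, Fintype.card_eq_zero, Nat.cast_zero,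
      zero_add]
    exact ENNReal.ofReal_le_ofReal (Real.one_le_exp (by positivity))
  set d : ℝ := (Fintype.card κ : ℝ) with hd
  have hd0 : 0 < d := by rw [hd]; exact_mod_cast Fintype.card_pos
  have hsd : 0 < √d := Real.sqrt_pos.2 hd0
  -- Linearise the norm R by s R ≤ s S / 2 + s R² / (2 S), reducing to a chi-square moment. This S
  -- makes 1 - 2a = √d / S, and the total exponent becomes exactly s√d + s²/2.
  set S := √d + s with hS
  have hS0 : 0 < S := by positivity
  set a := s / (2 * S) with ha
  have h2a : 1 - 2 * a = √d / S := by rw [ha]; field_simp; rw [hS]; ring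
  have ha2 : a < 1 / 2 := by
    have : 0 < 1 - 2 * a := by rw [h2a]; positivity
    linarith
  obtain ⟨hi, hval⟩ := integral_exp_mul_sq_gaussianReal ha2
  have hprod : Integrable (fun y : κ → ℝ => ∏ k, Real.exp (a * y k ^ 2)) (gauss κ) :=
    Integrable.fintype_prod fun _ => hi
  have hpt (y : κ → ℝ) : Real.exp (s * √(y ⬝ᵥ y)) ≤
      Real.exp (s * S / 2) * ∏ k, Real.exp (a * y k ^ 2) := by
    rw [← Real.exp_sum, ← Real.exp_add, Real.exp_le_exp, ← Finset.mul_sum]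
    have hsq : ∑ k, y k ^ 2 = √(y ⬝ᵥ y) ^ 2 := by
      have h0 : 0 ≤ y ⬝ᵥ y := Finset.sum_nonneg fun k _ => mul_self_nonneg (y k)
      rw [Real.sq_sqrt h0]
      simp [dotProduct, sq]
    rw [hsq]
    have : s * S / 2 + a * √(y ⬝ᵥ y) ^ 2 - s * √(y ⬝ᵥ y) =
        s / (2 * S) * (√(y ⬝ᵥ y) - S) ^ 2 := by
      rw [ha]; field_simp; ring
    have h0 : 0 ≤ s / (2 * S) * (√(y ⬝ᵥ y) - S) ^ 2 := by positivity
    linarith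
  have hfac : √(1 / (1 - 2 * a)) ≤ Real.exp (s / (2 * √d)) := by
    rw [h2a, one_div_div, Real.sqrt_le_left (Real.exp_pos _).le, ← Real.exp_nat_mul]
    have := Real.add_one_le_exp (s / √d)
    calc S / √d = s / √d + 1 := by rw [hS]; field_simp; ring
      _ ≤ _ := this
      _ = _ := by congr 1; push_cast; field_simp
  calc _ ≤ ∫⁻ y, ENNReal.ofReal (Real.exp (s * S / 2) * ∏ k, Real.exp (a * y k ^ 2)) ∂gauss κ :=
        lintegral_mono fun y => ENNReal.ofReal_le_ofReal (hpt y)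
    _ = ENNReal.ofReal (∫ y, Real.exp (s * S / 2) * ∏ k, Real.exp (a * y k ^ 2) ∂gauss κ) :=
        (ofReal_integral_eq_lintegral_ofReal (hprod.const_mul _)
          (.of_forall fun y => by positivity)).symm
    _ ≤ _ := by
        refine ENNReal.ofReal_le_ofReal ?_
        rw [integral_const_mul,
          integral_fintype_prod_eq_prod (f := fun (_ : κ) x => Real.exp (a * x ^ 2))]
        simp only [hval, Finset.prod_const, Finset.card_univ]
        calc _ ≤ Real.exp (s * S / 2) * Real.exp (s / (2 * √d)) ^ Fintype.card κ := by gcongr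
          _ = _ := by
            rw [← Real.exp_nat_mul, ← Real.exp_add, ← hd]
            congr 1
            have : d = √d * √d := (Real.mul_self_sqrt hd0.le).symm
            nth_rw 1 [this]
            rw [hS]
            field_simp
            ring

theorem lintegral_exp_eval_gauss_unit (s : ℝ) :
    ∫⁻ w, ENNReal.ofReal (Real.exp (s * w ())) ∂gauss Unit =
      ENNReal.ofReal (Real.exp (s ^ 2 / 2)) := by
  have hmp := measurePreserving_eval (fun _ : Unit => gaussianReal 0 1) ()
  have h1 : ∫⁻ w, ENNReal.ofReal (Real.exp (s * w ())) ∂gauss Unit =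
      ∫⁻ x, ENNReal.ofReal (Real.exp (s * x)) ∂gaussianReal 0 1 :=
    hmp.lintegral_comp (f := fun x => ENNReal.ofReal (Real.exp (s * x))) (by fun_prop)
  rw [h1, ← ofReal_integral_eq_lintegral_ofReal (integrable_exp_mul_gaussianReal s)
    (.of_forall fun x => (Real.exp_pos _).le)]
  have := congrFun (mgf_id_gaussianReal (μ := 0) (v := 1)) s
  simp only [mgf, id] at this
  rw [this]
  simp

theorem lintegral_gauss_sum {κ₁ κ₂ : Type*} [Fintype κ₁] [Fintype κ₂]
    {f : (κ₁ → ℝ) → ENNReal} {g : (κ₂ → ℝ) → ENNReal} (hf : Measurable f) (hg : Measurable g) :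
    ∫⁻ x, f (x ∘ Sum.inl) * g (x ∘ Sum.inr) ∂gauss (κ₁ ⊕ κ₂) =
      (∫⁻ x, f x ∂gauss κ₁) * ∫⁻ y, g y ∂gauss κ₂ := by
  have hmp := measurePreserving_sumPiEquivProdPi (fun _ : κ₁ ⊕ κ₂ => gaussianReal 0 1)
  rw [← lintegral_prod_mul hf.aemeasurable hg.aemeasurable]
  exact hmp.lintegral_comp (f := fun z : (κ₁ → ℝ) × (κ₂ → ℝ) => f z.1 * g z.2) (by fun_prop)

theorem dotProduct_le_sqrt_mul_sqrt {κ : Type*} [Fintype κ] (x y : κ → ℝ) :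
    x ⬝ᵥ y ≤ √(x ⬝ᵥ x) * √(y ⬝ᵥ y) := by
  simpa [dotProduct, sq] using Real.sum_mul_le_sqrt_mul_sqrt Finset.univ x y

/-- Chevet's inequality with Gaussian concentration, for a finite family of bilinear forms. -/
theorem chevet_finite {ι m r q : Type*} [Fintype ι] [Fintype m] [Fintype r] [Fintype q]
    (x : ι → m → ℝ) (u : ι → r → ℝ) (v : ι → q → ℝ) (hxu : ∀ i j, x i ⬝ᵥ x j = u i ⬝ᵥ u j)
    (hu : ∀ i, u i ⬝ᵥ u i = 1) (hv : ∀ i, v i ⬝ᵥ v i = 1) {t : ℝ} (ht : 0 < t) :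
    (gauss (m × q)).real {z | ∃ i, √(Fintype.card q : ℝ) + √(Fintype.card r : ℝ) + t <
      (fun p : m × q => x i p.1 * v i p.2) ⬝ᵥ z} ≤ Real.exp (-(t ^ 2 / 2)) := by
  rcases isEmpty_or_nonempty ι with hι | hι
  · simp only [IsEmpty.exists_iff, Set.ofPred_false, measureReal_empty]
    positivity
  set s : ℝ := √(Fintype.card q : ℝ) + √(Fintype.card r : ℝ) with hs
  let W : ι → m × q → ℝ := fun i p => x i p.1 * v i p.2
  -- The extra standard normal raises the variance from 1 to 2, matching that of `b`.
  let a : ι → (m × q) ⊕ Unit → ℝ := fun i => Sum.elim (W i) fun _ => 1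
  let b : ι → r ⊕ q → ℝ := fun i => Sum.elim (u i) (v i)
  have ha (i j : ι) : a i ⬝ᵥ a j = (u i ⬝ᵥ u j) * (v i ⬝ᵥ v j) + 1 := by
    rw [← hxu]
    simp only [a, W, dotProduct, Fintype.sum_sum_type, Sum.elim_inl, Sum.elim_inr,
      Finset.sum_mul_sum, Fintype.sum_prod_type, Finset.univ_unique, Finset.sum_singleton, mul_one]
    congr 1
    refine Finset.sum_congr rfl fun k _ => Finset.sum_congr rfl fun l _ => ?_
    ring
  have hb (i j : ι) : b i ⬝ᵥ b j = (u i ⬝ᵥ u j) + (v i ⬝ᵥ v j) := by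
    simp [b, dotProduct, Fintype.sum_sum_type]
  have hdiag (i : ι) : a i ⬝ᵥ a i = b i ⬝ᵥ b i := by rw [ha, hb, hu, hv]; norm_num
  have hle (i j : ι) : b i ⬝ᵥ b j ≤ a i ⬝ᵥ a j := by
    rw [ha, hb]
    have h1 := dotProduct_le_sqrt_mul_sqrt (u i) (u j)
    have h2 := dotProduct_le_sqrt_mul_sqrt (v i) (v j)
    simp only [hu, hv, Real.sqrt_one, mul_one] at h1 h2
    -- The difference is (1 - ⟨u i, u j⟩)(1 - ⟨v i, v j⟩), a product of nonnegative factors.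
    nlinarith
  let M : (m × q → ℝ) → ℝ := fun z => ⨆ i, W i ⬝ᵥ z
  have hM : Measurable M := .iSup fun i => Continuous.measurable (by fun_prop)
  let f : ((m × q) ⊕ Unit → ℝ) → ℝ := fun z => M (z ∘ Sum.inl) + (z ∘ Sum.inr) ()
  have hfm : Measurable f := by fun_prop
  let g : (r ⊕ q → ℝ) → ℝ := fun y => √((y ∘ Sum.inl) ⬝ᵥ (y ∘ Sum.inl)) +
    √((y ∘ Sum.inr) ⬝ᵥ (y ∘ Sum.inr))
  have hgm : Measurable g := Continuous.measurable (by fun_prop)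
  have htail (c₁ c₂ : ℝ) (hc : c₁ < c₂) :
      gauss _ {z | c₂ ≤ f z} ≤ gauss _ {y | c₁ < g y} := by
    have h := slepian a b hdiag hle hc
    have h' := ENNReal.ofReal_le_ofReal h
    rw [ofReal_measureReal, ofReal_measureReal] at h'
    refine (measure_mono fun z hz => ?_).trans (h'.trans (measure_mono fun y hy => ?_))
    · obtain ⟨i, hi⟩ := exists_eq_ciSup_of_finite (f := fun i => W i ⬝ᵥ (z ∘ Sum.inl))
      refine ⟨i, le_of_le_of_eq (b := f z) hz ?_⟩
      simp only [f, M, ← hi]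
      simp [a, dotProduct]
    · obtain ⟨i, hi⟩ := hy
      refine lt_of_lt_of_le (b := b i ⬝ᵥ y) hi ?_
      have h1 := dotProduct_le_sqrt_mul_sqrt (u i) (y ∘ Sum.inl)
      have h2 := dotProduct_le_sqrt_mul_sqrt (v i) (y ∘ Sum.inr)
      simp only [hu, hv, Real.sqrt_one, one_mul] at h1 h2
      calc b i ⬝ᵥ y = (u i ⬝ᵥ (y ∘ Sum.inl)) + (v i ⬝ᵥ (y ∘ Sum.inr)) := by
            simp [b, dotProduct]
        _ ≤ g y := add_le_add h1 h2
  have hmgf (δ : ℝ) (hδ : 0 < δ) : ∫⁻ z, ENNReal.ofReal (Real.exp (t * M z)) ∂gauss (m × q) ≤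
      ENNReal.ofReal (Real.exp (t * s + t ^ 2 / 2 + t * δ)) := by
    have h := lintegral_exp_le_of_tail_le hfm hgm htail ht hδ
    have hl : ∫⁻ z, ENNReal.ofReal (Real.exp (t * f z)) ∂gauss ((m × q) ⊕ Unit) =
        (∫⁻ z, ENNReal.ofReal (Real.exp (t * M z)) ∂gauss (m × q)) *
          ENNReal.ofReal (Real.exp (t ^ 2 / 2)) := by
      rw [← lintegral_exp_eval_gauss_unit, ← lintegral_gauss_sum (by fun_prop) (by fun_prop)]
      refine lintegral_congr fun z => ?_
      rw [← ENNReal.ofReal_mul (Real.exp_pos _).le, ← Real.exp_add]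
      simp only [f]
      ring_nf
    have hr : ∫⁻ y, ENNReal.ofReal (Real.exp (t * (g y + δ))) ∂gauss (r ⊕ q) ≤
        ENNReal.ofReal (Real.exp (t * s + t ^ 2 / 2 + t * δ)) *
          ENNReal.ofReal (Real.exp (t ^ 2 / 2)) := by
      calc _ = ∫⁻ y, (ENNReal.ofReal (Real.exp (t * √((y ∘ Sum.inl) ⬝ᵥ (y ∘ Sum.inl)))) *
            ENNReal.ofReal (Real.exp (t * √((y ∘ Sum.inr) ⬝ᵥ (y ∘ Sum.inr))))) *
            ENNReal.ofReal (Real.exp (t * δ)) ∂gauss (r ⊕ q) := by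
            refine lintegral_congr fun y => ?_
            rw [← ENNReal.ofReal_mul (Real.exp_pos _).le, ← ENNReal.ofReal_mul (by positivity),
              ← Real.exp_add, ← Real.exp_add]
            simp only [g]
            ring_nf
        _ = (∫⁻ y, ENNReal.ofReal (Real.exp (t * √(y ⬝ᵥ y))) ∂gauss r) *
            (∫⁻ y, ENNReal.ofReal (Real.exp (t * √(y ⬝ᵥ y))) ∂gauss q) *
            ENNReal.ofReal (Real.exp (t * δ)) := by
            rw [lintegral_mul_const' _ _ ENNReal.ofReal_ne_top]
            congr 1
            exact lintegral_gauss_sum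
              (f := fun y : r → ℝ => ENNReal.ofReal (Real.exp (t * √(y ⬝ᵥ y))))
              (g := fun y : q → ℝ => ENNReal.ofReal (Real.exp (t * √(y ⬝ᵥ y))))
              (ENNReal.measurable_ofReal.comp (Continuous.measurable (by fun_prop)))
              (ENNReal.measurable_ofReal.comp (Continuous.measurable (by fun_prop)))
        _ ≤ ENNReal.ofReal (Real.exp (t * √(Fintype.card r : ℝ) + t ^ 2 / 2)) *
            ENNReal.ofReal (Real.exp (t * √(Fintype.card q : ℝ) + t ^ 2 / 2)) *
            ENNReal.ofReal (Real.exp (t * δ)) := by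
            gcongr
            · exact lintegral_exp_norm_gauss_le r ht
            · exact lintegral_exp_norm_gauss_le q ht
        _ = _ := by
            rw [← ENNReal.ofReal_mul (Real.exp_pos _).le, ← ENNReal.ofReal_mul (by positivity),
              ← ENNReal.ofReal_mul (by positivity), ← Real.exp_add, ← Real.exp_add, ← Real.exp_add,
              hs]
            ring_nf
    rw [hl] at h
    -- Cancels the moment of the extra normal, leaving a single t²/2 in the exponent.
    exact (ENNReal.mul_le_mul_iff_left (by simpa using Real.exp_pos _)
      ENNReal.ofReal_ne_top).1 (h.trans hr)
  have hbound (δ : ℝ) (hδ : 0 < δ) :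
      (gauss (m × q)).real {z | ∃ i, s + t < W i ⬝ᵥ z} ≤ Real.exp (-(t ^ 2 / 2) + t * δ) := by
    have hsub : {z : m × q → ℝ | ∃ i, s + t < W i ⬝ᵥ z} ⊆
        {z | ENNReal.ofReal (Real.exp (t * (s + t))) ≤ ENNReal.ofReal (Real.exp (t * M z))} := by
      rintro z ⟨i, hi⟩
      refine ENNReal.ofReal_le_ofReal (Real.exp_le_exp.2 (mul_le_mul_of_nonneg_left ?_ ht.le))
      exact hi.le.trans (le_ciSup (f := fun i => W i ⬝ᵥ z) (Set.finite_range _).bddAbove i)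
    have hmk := mul_meas_ge_le_lintegral (μ := gauss (m × q))
      (f := fun z => ENNReal.ofReal (Real.exp (t * M z))) (by fun_prop)
      (ENNReal.ofReal (Real.exp (t * (s + t))))
    have h := ((mul_le_mul_right (measure_mono (μ := gauss (m × q)) hsub) _).trans hmk).trans
      (hmgf δ hδ)
    rw [← ofReal_measureReal, ← ENNReal.ofReal_mul (Real.exp_pos _).le,
      ENNReal.ofReal_le_ofReal_iff (Real.exp_pos _).le, mul_comm, ← le_div_iff₀ (Real.exp_pos _),
      ← Real.exp_sub] at h
    refine h.trans_eq ?_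
    congr 1
    ring
  have hlim : Filter.Tendsto (fun δ : ℝ => Real.exp (-(t ^ 2 / 2) + t * δ))
      (nhdsWithin 0 (Set.Ioi 0)) (nhds (Real.exp (-(t ^ 2 / 2) + t * 0))) :=
    (Continuous.tendsto (by fun_prop) _).mono_left nhdsWithin_le_nhds
  have := ge_of_tendsto hlim (Filter.eventually_of_mem self_mem_nhdsWithin hbound)
  simpa using this

/-! ### Singular values and operator/nuclear duality -/

section SingularValues

variable {E F : Type*} [NormedAddCommGroup E] [InnerProductSpace ℝ E] [FiniteDimensional ℝ E]
  [NormedAddCommGroup F] [InnerProductSpace ℝ F] [FiniteDimensional ℝ F] (T : E →ₗ[ℝ] F)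

/-- The eigenvectors of T*T are right singular vectors: ‖T b‖² = ⟨T*T b, b⟩ is the eigenvalue at b.
-/
theorem norm_apply_eigenvectorBasis {n : ℕ} (hn : Module.finrank ℝ E = n) (i : Fin n) :
    ‖T (T.isSymmetric_adjoint_comp_self.eigenvectorBasis hn i)‖ = T.singularValues i := by
  have h := T.isSymmetric_adjoint_comp_self.apply_eigenvectorBasis hn i
  rw [← sq_eq_sq₀ (norm_nonneg _) (T.singularValues_nonneg _), T.sq_singularValues_fin hn,
    ← real_inner_self_eq_norm_sq, ← LinearMap.adjoint_inner_left, ← LinearMap.comp_apply, h,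
    inner_smul_left, real_inner_self_eq_norm_sq]
  simp

theorem norm_apply_le_singularValues_zero_mul (x : E) : ‖T x‖ ≤ T.singularValues 0 * ‖x‖ := by
  set b := T.isSymmetric_adjoint_comp_self.eigenvectorBasis rfl with hb
  rw [← sq_le_sq₀ (norm_nonneg _) (mul_nonneg (T.singularValues_nonneg _) (norm_nonneg _)),
    mul_pow, ← real_inner_self_eq_norm_sq, ← LinearMap.adjoint_inner_left, ← LinearMap.comp_apply,
    ← b.sum_inner_mul_inner, ← b.sum_sq_norm_inner_right x, Finset.mul_sum]
  refine Finset.sum_le_sum fun i _ => ?_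
  have h := T.isSymmetric_adjoint_comp_self.apply_eigenvectorBasis rfl i
  rw [T.isSymmetric_adjoint_comp_self x (b i), hb, h, ← hb, inner_smul_right,
    real_inner_comm x (b i), RCLike.ofReal_real_eq_id, id, ← T.sq_singularValues_fin rfl,
    Real.norm_eq_abs, sq_abs, mul_assoc, ← sq]
  refine mul_le_mul_of_nonneg_right ?_ (sq_nonneg _)
  exact pow_le_pow_left₀ (T.singularValues_nonneg _) (T.singularValues_antitone (Nat.zero_le _)) 2

theorem exists_norm_apply_eq_singularValues_zero (h : T.singularValues 0 ≠ 0) :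
    ∃ x, ‖x‖ = 1 ∧ ‖T x‖ = T.singularValues 0 := by
  have hn : 0 < Module.finrank ℝ E := by
    by_contra hcon
    exact h (T.singularValues_of_finrank_le (by omega))
  exact ⟨T.isSymmetric_adjoint_comp_self.eigenvectorBasis rfl ⟨0, hn⟩,
    OrthonormalBasis.norm_eq_one _ _, norm_apply_eigenvectorBasis T rfl ⟨0, hn⟩⟩

end SingularValues

theorem singularValue_nonneg {m n : ℕ} (A : Matrix (Fin m) (Fin n) ℝ) (j : ℕ) :
    0 ≤ singularValue A j := LinearMap.singularValues_nonneg _ _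

theorem nuclearNorm_nonneg {m n : ℕ} (A : Matrix (Fin m) (Fin n) ℝ) : 0 ≤ nuclearNorm A :=
  Finset.sum_nonneg fun _ _ => singularValue_nonneg _ _

theorem inner_toEuclideanLin {m n : ℕ} (A : Matrix (Fin m) (Fin n) ℝ)
    (y : EuclideanSpace ℝ (Fin m)) (x : EuclideanSpace ℝ (Fin n)) :
    inner ℝ y (Matrix.toEuclideanLin A x) = y.ofLp ⬝ᵥ A.mulVec x.ofLp := by
  rw [Matrix.toLpLin_apply, EuclideanSpace.inner_eq_star_dotProduct, dotProduct_comm]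
  simp

/-- Cauchy–Schwarz one way; the other way tests a top singular vector x against y = Ax/‖Ax‖. The
sign of c matters for empty matrices, where there are no unit vectors and the right side is vacuous.
-/
theorem singularValue_zero_le_iff {m n : ℕ} (A : Matrix (Fin m) (Fin n) ℝ) {c : ℝ} (hc : 0 ≤ c) :
    singularValue A 0 ≤ c ↔ ∀ (y : EuclideanSpace ℝ (Fin m)) (x : EuclideanSpace ℝ (Fin n)),
      ‖y‖ = 1 → ‖x‖ = 1 → y.ofLp ⬝ᵥ A.mulVec x.ofLp ≤ c := by
  constructor
  · intro h y x hy hx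
    rw [← inner_toEuclideanLin]
    refine (real_inner_le_norm _ _).trans ?_
    have := norm_apply_le_singularValues_zero_mul (Matrix.toEuclideanLin A) x
    rw [hx, mul_one] at this
    rw [hy, one_mul]
    exact this.trans h
  · intro h
    by_contra! hcon
    have h0 : 0 < singularValue A 0 := hc.trans_lt hcon
    obtain ⟨x, hx, hTx⟩ := exists_norm_apply_eq_singularValues_zero (Matrix.toEuclideanLin A) h0.ne'
    have hT : 0 < ‖Matrix.toEuclideanLin A x‖ := by rw [hTx]; exact h0
    have := h (‖Matrix.toEuclideanLin A x‖⁻¹ • Matrix.toEuclideanLin A x) x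
      (by rw [norm_smul, norm_inv, norm_norm, inv_mul_cancel₀ hT.ne']) hx
    rw [← inner_toEuclideanLin, inner_smul_left, real_inner_self_eq_norm_sq] at this
    have h2 : ‖Matrix.toEuclideanLin A x‖ ≤ c := by
      refine le_trans (le_of_eq ?_) this
      simp only [conj_trivial]
      field_simp
    rw [hTx] at h2
    exact absurd hcon (not_lt.2 h2)

/-- Indices beyond the rank contribute zero, so the sum can run over an eigenbasis of the domain, as
the trace computation for duality requires. -/
theorem nuclearNorm_eq_sum_fin {m n : ℕ} (A : Matrix (Fin m) (Fin n) ℝ) :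
    nuclearNorm A = ∑ j : Fin n, singularValue A j := by
  rw [nuclearNorm, Fin.sum_univ_eq_sum_range (fun j => singularValue A j)]
  refine Finset.sum_subset (Finset.range_subset_range.2 (min_le_right _ _)) fun j hj hj' => ?_
  rw [Finset.mem_range] at hj hj'
  refine (LinearMap.singularValues_eq_zero_iff_le_finrank_range _).2 ?_
  have := Submodule.finrank_le (LinearMap.range (Matrix.toEuclideanLin A))
  rw [finrank_euclideanSpace_fin] at this
  omega

/-- Duality between the operator norm and the nuclear norm. -/
theorem sum_mul_le_singularValue_zero_mul_nuclearNorm {m n : ℕ} (M B : Matrix (Fin m) (Fin n) ℝ) :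
    ∑ i, ∑ j, M i j * B i j ≤ singularValue M 0 * nuclearNorm B := by
  set S := Matrix.toEuclideanLin M with hS
  set T := Matrix.toEuclideanLin B with hT
  have hn : Module.finrank ℝ (EuclideanSpace ℝ (Fin n)) = n := finrank_euclideanSpace_fin
  set b := T.isSymmetric_adjoint_comp_self.eigenvectorBasis hn with hb
  have h1 : ∑ i, ∑ j, M i j * B i j = LinearMap.trace ℝ _ (LinearMap.adjoint S ∘ₗ T) := by
    rw [LinearMap.trace_eq_sum_inner _ (EuclideanSpace.basisFun (Fin n) ℝ), Finset.sum_comm]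
    refine Finset.sum_congr rfl fun j _ => ?_
    rw [LinearMap.comp_apply, LinearMap.adjoint_inner_right, inner_toEuclideanLin, hS,
      Matrix.toLpLin_apply]
    simp [dotProduct]
  -- The trace is basis-free: in the right singular basis of B each term is ⟨M b, B b⟩ ≤ σ(M, 1)‖B
  -- b‖.
  rw [h1, LinearMap.trace_eq_sum_inner _ b, nuclearNorm_eq_sum_fin, Finset.mul_sum]
  refine Finset.sum_le_sum fun j _ => ?_
  rw [LinearMap.comp_apply, LinearMap.adjoint_inner_right]
  refine (real_inner_le_norm _ _).trans ?_
  have h2 := norm_apply_le_singularValues_zero_mul S (b j)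
  rw [b.norm_eq_one, mul_one] at h2
  rw [hb, norm_apply_eigenvectorBasis T hn j, ← hb]
  exact mul_le_mul_of_nonneg_right h2 (LinearMap.singularValues_nonneg _ _)

theorem abs_sum_mul_le_singularValue_zero_mul_nuclearNorm {m n : ℕ}
    (M B : Matrix (Fin m) (Fin n) ℝ) :
    |∑ i, ∑ j, M i j * B i j| ≤ singularValue M 0 * nuclearNorm B := by
  refine abs_le'.2 ⟨sum_mul_le_singularValue_zero_mul_nuclearNorm M B, ?_⟩
  have h := sum_mul_le_singularValue_zero_mul_nuclearNorm (-M) B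
  have hneg : singularValue (-M) 0 ≤ singularValue M 0 := by
    rw [singularValue_zero_le_iff _ (singularValue_nonneg _ _)]
    intro y x hy hx
    have := (singularValue_zero_le_iff M (singularValue_nonneg _ _)).1 le_rfl (-y) x
      (by rwa [norm_neg]) hx
    simpa [Matrix.neg_mulVec] using this
  refine le_trans (le_of_eq ?_) (h.trans (mul_le_mul_of_nonneg_right hneg (nuclearNorm_nonneg B)))
  simp

theorem frobenius_norm_sq {m n : Type*} [Fintype m] [Fintype n] (A : Matrix m n ℝ) :
    ‖A‖ ^ 2 = ∑ i, ∑ j, A i j ^ 2 := by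
  have h0 : 0 ≤ ∑ i, ∑ j, A i j ^ 2 := by positivity
  rw [Matrix.frobenius_norm_def]
  simp only [Real.rpow_two, Real.norm_eq_abs, sq_abs]
  rw [← Real.sqrt_eq_rpow, Real.sq_sqrt h0]

theorem frobenius_norm_sub_sq {m n : Type*} [Fintype m] [Fintype n] (A B : Matrix m n ℝ) :
    ‖A - B‖ ^ 2 = ‖A‖ ^ 2 - 2 * ∑ i, ∑ j, A i j * B i j + ‖B‖ ^ 2 := by
  simp only [frobenius_norm_sq, Finset.mul_sum, ← Finset.sum_sub_distrib, ← Finset.sum_add_distrib,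
    Matrix.sub_apply]
  refine Finset.sum_congr rfl fun i _ => Finset.sum_congr rfl fun j _ => ?_
  ring

/-! ### The deterministic oracle inequality -/

section Blocks

variable {n K q : ℕ} {p : Fin K → ℕ}

/-- Adjointness ⟨E, XB⟩ = ⟨XᵀE, B⟩, with the rows grouped by block, lets duality be applied to each
X_kᵀE separately. -/
theorem sum_mul_mul_eq_sum_blocks (X : Matrix (Fin n) ((k : Fin K) × Fin (p k)) ℝ)
    (E : Matrix (Fin n) (Fin q) ℝ) (B : Matrix ((k : Fin K) × Fin (p k)) (Fin q) ℝ) :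
    ∑ i, ∑ j, E i j * (X * B) i j =
      ∑ k, ∑ l, ∑ j, ((colBlock X k).transpose * E) l j * rowBlock B k l j := by
  have h : ∑ i, ∑ j, E i j * (X * B) i j = ∑ kl : (k : Fin K) × Fin (p k), ∑ j,
      (X.transpose * E) kl j * B kl j := by
    simp only [Matrix.mul_apply, Matrix.transpose_apply, Finset.mul_sum, Finset.sum_mul]
    rw [Finset.sum_congr rfl fun i _ => Finset.sum_comm, Finset.sum_comm]
    refine Finset.sum_congr rfl fun kl _ => ?_
    rw [Finset.sum_comm]
    refine Finset.sum_congr rfl fun j _ => Finset.sum_congr rfl fun i _ => ?_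
    ring
  rw [h, Fintype.sum_sigma]
  rfl

/-- The oracle inequality on the event where the penalty dominates the noise in every block. -/
theorem oracle_inequality_of_noise_le (hn : 0 < n)
    (X : Matrix (Fin n) ((k : Fin K) × Fin (p k)) ℝ)
    (B₀ : Matrix ((k : Fin K) × Fin (p k)) (Fin q) ℝ) (E : Matrix (Fin n) (Fin q) ℝ) {lam : ℝ}
    (hE : ∀ k, singularValue ((colBlock X k).transpose * E) 0 ≤
      lam * (singularValue (colBlock X k) 0 * (√(q : ℝ) + √((colBlock X k).rank : ℝ))))
    {Bhat : Matrix ((k : Fin K) × Fin (p k)) (Fin q) ℝ}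
    (hB : IsEstimate X (X * B₀ + E) lam Bhat)
    (C : Matrix ((k : Fin K) × Fin (p k)) (Fin q) ℝ) :
    ‖X * Bhat - X * B₀‖ ^ 2 ≤ ‖X * C - X * B₀‖ ^ 2 +
      4 * lam * ∑ k, singularValue (colBlock X k) 0 *
        (√(q : ℝ) + √((colBlock X k).rank : ℝ)) * nuclearNorm (rowBlock C k) := by
  have hn' : (0 : ℝ) < n := by exact_mod_cast hn
  have hmin : criterion X (X * B₀ + E) lam (weight q X) Bhat ≤
      criterion X (X * B₀ + E) lam (weight q X) C := hB (Set.mem_univ C)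
  set pen : Matrix ((k : Fin K) × Fin (p k)) (Fin q) ℝ → ℝ := fun B =>
    ∑ k, singularValue (colBlock X k) 0 * (√(q : ℝ) + √((colBlock X k).rank : ℝ)) *
      nuclearNorm (rowBlock B k) with hpen
  have hnoise (B : Matrix ((k : Fin K) × Fin (p k)) (Fin q) ℝ) :
      |∑ i, ∑ j, E i j * (X * B) i j| ≤ lam * pen B := by
    rw [sum_mul_mul_eq_sum_blocks, hpen, Finset.mul_sum]
    refine (Finset.abs_sum_le_sum_abs _ _).trans (Finset.sum_le_sum fun k _ => ?_)
    refine (abs_sum_mul_le_singularValue_zero_mul_nuclearNorm _ _).trans ?_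
    rw [← mul_assoc]
    exact mul_le_mul_of_nonneg_right (hE k) (nuclearNorm_nonneg _)
  have hcrit (B : Matrix ((k : Fin K) × Fin (p k)) (Fin q) ℝ) :
      2 * n * criterion X (X * B₀ + E) lam (weight q X) B =
        ‖E‖ ^ 2 - 2 * (∑ i, ∑ j, E i j * (X * B) i j - ∑ i, ∑ j, E i j * (X * B₀) i j) +
          ‖X * B - X * B₀‖ ^ 2 + 2 * lam * pen B := by
    have h1 : X * B₀ + E - X * B = E - (X * B - X * B₀) := by abel
    have h2 : ∑ k, weight q X k * nuclearNorm (rowBlock B k) = pen B / n := by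
      rw [hpen, Finset.sum_div]
      refine Finset.sum_congr rfl fun k _ => ?_
      rw [weight]
      ring
    rw [criterion, h2, h1, frobenius_norm_sub_sq]
    simp only [Matrix.sub_apply, mul_sub, Finset.sum_sub_distrib]
    field_simp
  have h1 := hcrit Bhat
  have h2 := hcrit C
  have h3 := mul_le_mul_of_nonneg_left hmin (by positivity : (0 : ℝ) ≤ 2 * n)
  have h4 := (abs_le.1 (hnoise Bhat)).2
  have h5 := (abs_le.1 (hnoise C)).1
  change _ ≤ _ + 4 * lam * pen C
  linarith

end Blocks

/-! ### Tail bound for the noise in one block -/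

/-- Chevet's inequality with Gaussian concentration, for a separable family of bilinear forms. -/
theorem chevet_separable {T m r q : Type*} [TopologicalSpace T] [TopologicalSpace.SeparableSpace T]
    [Fintype m] [Fintype r] [Fintype q] (x : T → m → ℝ) (u : T → r → ℝ) (v : T → q → ℝ)
    (hxc : Continuous x) (hvc : Continuous v) (hxu : ∀ i j, x i ⬝ᵥ x j = u i ⬝ᵥ u j)
    (hu : ∀ i, u i ⬝ᵥ u i = 1) (hv : ∀ i, v i ⬝ᵥ v i = 1) {t : ℝ} (ht : 0 < t) :
    (gauss (m × q)).real {z | ∃ i, √(Fintype.card q : ℝ) + √(Fintype.card r : ℝ) + t <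
      (fun p : m × q => x i p.1 * v i p.2) ⬝ᵥ z} ≤ Real.exp (-(t ^ 2 / 2)) := by
  rcases isEmpty_or_nonempty T with hT | hT
  · simp only [IsEmpty.exists_iff, Set.ofPred_false, measureReal_empty]
    positivity
  set s : ℝ := √(Fintype.card q : ℝ) + √(Fintype.card r : ℝ) + t
  let d := TopologicalSpace.denseSeq T
  let A : ℕ → Set (m × q → ℝ) := fun N =>
    {z | ∃ i : Fin N, s < (fun p : m × q => x (d i) p.1 * v (d i) p.2) ⬝ᵥ z}
  -- A strict inequality is open in the index, so any exceedance is already seen on the dense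
  -- sequence. The finite bound then passes to the increasing union.
  have hsub : {z | ∃ i, s < (fun p : m × q => x i p.1 * v i p.2) ⬝ᵥ z} ⊆ ⋃ N, A N := by
    rintro z ⟨i, hi⟩
    have hopen : IsOpen {i : T | s < (fun p : m × q => x i p.1 * v i p.2) ⬝ᵥ z} :=
      isOpen_lt continuous_const (by fun_prop)
    obtain ⟨j, hj⟩ := (TopologicalSpace.denseRange_denseSeq T).exists_mem_open hopen ⟨i, hi⟩
    exact Set.mem_iUnion.2 ⟨j + 1, ⟨j, Nat.lt_succ_self j⟩, hj⟩
  have hmono : Monotone A := by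
    rintro N N' hN z ⟨i, hi⟩
    exact ⟨Fin.castLE hN i, hi⟩
  have hle : gauss (m × q) (⋃ N, A N) ≤ ENNReal.ofReal (Real.exp (-(t ^ 2 / 2))) := by
    rw [hmono.measure_iUnion]
    refine iSup_le fun N => ?_
    rw [← ofReal_measureReal]
    exact ENNReal.ofReal_le_ofReal (chevet_finite (fun i : Fin N => x (d i)) (fun i => u (d i))
      (fun i => v (d i)) (fun _ _ => hxu _ _) (fun _ => hu _) (fun _ => hv _) ht)
  exact ENNReal.toReal_le_of_le_ofReal (Real.exp_pos _).le ((measure_mono hsub).trans hle)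

theorem rank_eq_finrank_range_toEuclideanLin {m n : ℕ} (A : Matrix (Fin m) (Fin n) ℝ) :
    A.rank = Module.finrank ℝ (LinearMap.range (Matrix.toEuclideanLin A)) :=
  A.rank_eq_finrank_range_toLin (EuclideanSpace.basisFun (Fin m) ℝ).toBasis
    (EuclideanSpace.basisFun (Fin n) ℝ).toBasis

theorem dotProduct_self_eq_norm_sq {κ : Type*} [Fintype κ] (x : EuclideanSpace ℝ κ) :
    x.ofLp ⬝ᵥ x.ofLp = ‖x‖ ^ 2 := by
  rw [EuclideanSpace.real_norm_sq_eq]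
  simp [dotProduct, sq]

/-- The largest singular value of `Xᵀ Z`, for a standard Gaussian matrix `Z`. -/
theorem gauss_singularValue_gt_le {n p q : ℕ} (X : Matrix (Fin n) (Fin p) ℝ) {θ : ℝ} (hθ : 0 < θ) :
    (gauss (Fin n × Fin q)).real {z | (1 + θ) * (singularValue X 0 * (√(q : ℝ) + √(X.rank : ℝ))) <
      singularValue (X.transpose * Matrix.of fun i j => z (i, j)) 0} ≤
      Real.exp (-(θ ^ 2 * ((q : ℝ) + (X.rank : ℝ)) / 2)) := by
  set s : ℝ := √(q : ℝ) + √(X.rank : ℝ) with hs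
  have hs0 : 0 ≤ s := by positivity
  -- Chevet is used at t = θs, which must be positive. If s = 0 then q = r(X) = 0 and the claimed
  -- bound is 1.
  rcases hs0.eq_or_lt with hs' | hs'
  · have hq : √(q : ℝ) = 0 := by
      have := Real.sqrt_nonneg (q : ℝ); have := Real.sqrt_nonneg (X.rank : ℝ); linarith
    have hr : √(X.rank : ℝ) = 0 := by linarith
    have hq' : (q : ℝ) = 0 := (Real.sqrt_eq_zero (by positivity)).1 hq
    have hr' : (X.rank : ℝ) = 0 := (Real.sqrt_eq_zero (by positivity)).1 hr
    rw [hq', hr']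
    simp only [add_zero, mul_zero, zero_div, neg_zero, Real.exp_zero]
    exact measureReal_le_one
  let L := Matrix.toEuclideanLin X
  let V := LinearMap.range L
  let B := stdOrthonormalBasis ℝ V
  have hinner (a b : EuclideanSpace ℝ (Fin n)) : a.ofLp ⬝ᵥ b.ofLp = inner ℝ a b := by
    rw [EuclideanSpace.inner_eq_star_dotProduct, dotProduct_comm]; simp
  -- Unit vectors of the range have the same Gram matrix as their coordinates in an orthonormal
  -- basis. Those coordinates live in dimension r(X), which is how the rank replaces n.
  have hch := chevet_separable 
    (T := Metric.sphere (0 : V) 1 × Metric.sphere (0 : EuclideanSpace ℝ (Fin q)) 1) (m := Fin n) (q := Fin q)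
    (fun i => ((i.1 : V) : EuclideanSpace ℝ (Fin n)).ofLp) (fun i => (B.repr i.1).ofLp)
    (fun i => (i.2 : EuclideanSpace ℝ (Fin q)).ofLp) (by fun_prop) (by fun_prop)
    (fun i j => by
      rw [hinner, ← Submodule.coe_inner, ← B.repr.inner_map_map,
        EuclideanSpace.inner_eq_star_dotProduct, dotProduct_comm]
      simp)
    (fun i => by
      rw [dotProduct_self_eq_norm_sq, LinearIsometryEquiv.norm_map, norm_eq_of_mem_sphere, one_pow])
    (fun i => by rw [dotProduct_self_eq_norm_sq, norm_eq_of_mem_sphere, one_pow])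
    (t := θ * s) (by positivity)
  simp only [Fintype.card_fin] at hch
  rw [← rank_eq_finrank_range_toEuclideanLin, ← hs] at hch
  refine (measureReal_mono fun z hz => ?_).trans (hch.trans (Real.exp_le_exp.2 ?_))
  · set Z : Matrix (Fin n) (Fin q) ℝ := Matrix.of fun i j => z (i, j) with hZ
    have hc : 0 ≤ (1 + θ) * (singularValue X 0 * s) := by
      have := singularValue_nonneg X 0; positivity
    have hz' : ¬ singularValue (X.transpose * Z) 0 ≤ (1 + θ) * (singularValue X 0 * s) := not_le.2 hz
    rw [singularValue_zero_le_iff _ hc] at hz'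
    push Not at hz'
    obtain ⟨w, y, hw, hy, hlt⟩ := hz'
    have hval : w.ofLp ⬝ᵥ (X.transpose * Z).mulVec y.ofLp = (L w).ofLp ⬝ᵥ Z.mulVec y.ofLp := by
      rw [← Matrix.mulVec_mulVec, Matrix.dotProduct_mulVec, Matrix.vecMul_transpose]
      rfl
    rw [hval] at hlt
    have hLw : ‖L w‖ ≤ singularValue X 0 := by
      have := norm_apply_le_singularValues_zero_mul L w
      rwa [hw, mul_one] at this
    have hLw0 : 0 < ‖L w‖ := by
      rw [norm_pos_iff]
      intro h0
      rw [h0] at hlt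
      simp only [WithLp.ofLp_zero, zero_dotProduct] at hlt
      linarith
    refine ⟨⟨⟨⟨‖L w‖⁻¹ • L w, V.smul_mem _ ⟨w, rfl⟩⟩, ?_⟩, ⟨y, by simpa using hy⟩⟩, ?_⟩
    · rw [mem_sphere_zero_iff_norm, Submodule.coe_norm, norm_smul, norm_inv, norm_norm,
        inv_mul_cancel₀ hLw0.ne']
    · have hsum : (fun p : Fin n × Fin q => (‖L w‖⁻¹ • L w).ofLp p.1 * y.ofLp p.2) ⬝ᵥ z =
          ‖L w‖⁻¹ * ((L w).ofLp ⬝ᵥ Z.mulVec y.ofLp) := by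
        simp only [dotProduct, Matrix.mulVec, Fintype.sum_prod_type, Finset.mul_sum, hZ,
          Matrix.of_apply, WithLp.ofLp_smul, Pi.smul_apply, smul_eq_mul]
        refine Finset.sum_congr rfl fun i _ => Finset.sum_congr rfl fun j _ => ?_
        ring
      change s + θ * s < _
      rw [hsum, inv_mul_eq_div, lt_div_iff₀ hLw0]
      refine lt_of_le_of_lt ?_ hlt
      have := mul_le_mul_of_nonneg_left hLw (show 0 ≤ (1 + θ) * s by positivity)
      linarith
  -- Weakens the exponent θ²s²/2 given by Chevet to the stated one.
  · have h1 : (q : ℝ) + (X.rank : ℝ) ≤ s ^ 2 := by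
      rw [hs, add_sq, Real.sq_sqrt (by positivity), Real.sq_sqrt (by positivity)]
      have : 0 ≤ 2 * √(q : ℝ) * √(X.rank : ℝ) := by positivity
      linarith
    have := mul_le_mul_of_nonneg_left h1 (sq_nonneg θ)
    rw [mul_pow]
    linarith

/-- By the variational description the complement is an intersection of closed conditions linear in
z, hence closed even though the family is uncountable. -/
theorem measurableSet_singularValue_zero_gt {n p q : ℕ} (X : Matrix (Fin n) (Fin p) ℝ) {c : ℝ}
    (hc : 0 ≤ c) :
    MeasurableSet {z : Fin n × Fin q → ℝ |
      c < singularValue (X.transpose * Matrix.of fun i j => z (i, j)) 0} := by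
  have : {z : Fin n × Fin q → ℝ |
      c < singularValue (X.transpose * Matrix.of fun i j => z (i, j)) 0}ᶜ =
      ⋂ (y : EuclideanSpace ℝ (Fin p)) (x : EuclideanSpace ℝ (Fin q)) (_ : ‖y‖ = 1) (_ : ‖x‖ = 1),
        {z | y.ofLp ⬝ᵥ (X.transpose * Matrix.of fun i j => z (i, j)).mulVec x.ofLp ≤ c} := by
    ext z
    simp only [Set.mem_compl_iff, Set.mem_ofPred_eq, not_lt, Set.mem_iInter,
      singularValue_zero_le_iff _ hc]
  refine MeasurableSet.of_compl ?_
  rw [this]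
  refine IsClosed.measurableSet (isClosed_iInter fun y => isClosed_iInter fun x =>
    isClosed_iInter fun _ => isClosed_iInter fun _ => isClosed_le ?_ continuous_const)
  simp only [dotProduct, Matrix.mulVec, Matrix.mul_apply, Matrix.of_apply]
  fun_prop

theorem singularValue_smul_zero_le {m n : ℕ} (A : Matrix (Fin m) (Fin n) ℝ) {c : ℝ} (hc : 0 ≤ c) :
    singularValue (c • A) 0 ≤ c * singularValue A 0 := by
  rw [singularValue_zero_le_iff _ (mul_nonneg hc (singularValue_nonneg _ _))]
  intro y x hy hx
  rw [Matrix.smul_mulVec, dotProduct_smul, smul_eq_mul]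
  exact mul_le_mul_of_nonneg_left
    ((singularValue_zero_le_iff A (singularValue_nonneg _ _)).1 le_rfl y x hy hx) hc

/-- Tail bound for the noise level in one block. -/
theorem gaussian_singularValue_gt_le {n p q : ℕ} (X : Matrix (Fin n) (Fin p) ℝ) (τ : ℝ≥0) {θ : ℝ}
    (hθ : 0 < θ) :
    (Measure.pi fun _ : Fin n × Fin q => gaussianReal 0 (τ ^ 2)).real
      {z | (1 + θ) * τ * (singularValue X 0 * (√(q : ℝ) + √(X.rank : ℝ))) <
        singularValue (X.transpose * Matrix.of fun i j => z (i, j)) 0} ≤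
      Real.exp (-(θ ^ 2 * ((q : ℝ) + (X.rank : ℝ)) / 2)) := by
  have hτ : gaussianReal 0 (τ ^ 2) = (gaussianReal 0 1).map fun x => (τ : ℝ) * x := by
    rw [gaussianReal_map_const_mul]
    congr 1
    · simp
    · ext; simp
  have hmp : MeasurePreserving (fun (z : Fin n × Fin q → ℝ) p => (τ : ℝ) * z p)
      (gauss (Fin n × Fin q)) (Measure.pi fun _ : Fin n × Fin q => gaussianReal 0 (τ ^ 2)) :=
    measurePreserving_pi _ _ fun _ => ⟨by fun_prop, hτ.symm⟩
  have hpos : 0 ≤ singularValue X 0 * (√(q : ℝ) + √(X.rank : ℝ)) :=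
    mul_nonneg (singularValue_nonneg _ _) (by positivity)
  have hpos' : 0 ≤ (1 + θ) * τ * (singularValue X 0 * (√(q : ℝ) + √(X.rank : ℝ))) := by positivity
  rw [measureReal_def, ← hmp.measure_preimage
    (measurableSet_singularValue_zero_gt X hpos').nullMeasurableSet, ← measureReal_def]
  refine (measureReal_mono fun z hz => ?_).trans (gauss_singularValue_gt_le X hθ)
  have h1 : X.transpose * (Matrix.of fun i j => (τ : ℝ) * z (i, j)) =
      (τ : ℝ) • (X.transpose * Matrix.of fun i j => z (i, j)) := by
    rw [← Matrix.mul_smul]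
    rfl
  have h2 : (1 + θ) * τ * (singularValue X 0 * (√(q : ℝ) + √(X.rank : ℝ))) <
      singularValue (X.transpose * Matrix.of fun i j => (τ : ℝ) * z (i, j)) 0 := hz
  rw [h1] at h2
  have h3 := h2.trans_le (singularValue_smul_zero_le _ τ.2)
  -- Cancelling needs only τ ≥ 0: at τ = 0 the strict inequality `h3` is already contradictory.
  refine lt_of_mul_lt_mul_left (a := (τ : ℝ)) ?_ τ.2
  linarith

end IRRR

/-! ### Union bound over the blocks -/

theorem theorem1 {n K q : ℕ} (hn : 0 < n) {p : Fin K → ℕ}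
    (X : Matrix (Fin n) ((k : Fin K) × Fin (p k)) ℝ)
    (B₀ : Matrix ((k : Fin K) × Fin (p k)) (Fin q) ℝ)
    {Ω : Type*} [MeasurableSpace Ω] (μ : Measure Ω) [IsProbabilityMeasure μ]
    (E : Ω → Matrix (Fin n) (Fin q) ℝ) (τ : ℝ≥0)
    (hE_indep : iIndepFun (fun (ij : Fin n × Fin q) (ω : Ω) => E ω ij.1 ij.2) μ)
    (hE_law : ∀ i j, HasLaw (fun ω => E ω i j) (gaussianReal 0 (τ ^ 2)) μ)
    (θ : ℝ) (hθ : 0 < θ) (lam : ℝ) (hlam : lam = (1 + θ) * τ) :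
    ∃ A : Set Ω, MeasurableSet A ∧
      1 - ∑ k, Real.exp (-(θ ^ 2 * ((q : ℝ) + ((IRRR.colBlock X k).rank : ℝ)) / 2)) ≤ μ.real A ∧
      ∀ ω ∈ A, ∀ Bhat, IRRR.IsEstimate X (X * B₀ + E ω) lam Bhat →
        ∀ C : Matrix ((k : Fin K) × Fin (p k)) (Fin q) ℝ,
          ‖X * Bhat - X * B₀‖ ^ 2 ≤ ‖X * C - X * B₀‖ ^ 2 +
            4 * lam * ∑ k, IRRR.singularValue (IRRR.colBlock X k) 0 *
              (√(q : ℝ) + √((IRRR.colBlock X k).rank : ℝ)) *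
                IRRR.nuclearNorm (IRRR.rowBlock C k) := by
  let e : Ω → Fin n × Fin q → ℝ := fun ω ij => E ω ij.1 ij.2
  have hem : AEMeasurable e μ := aemeasurable_pi_lambda _ fun ij => (hE_law ij.1 ij.2).aemeasurable
  have hlaw : μ.map e = Measure.pi fun _ : Fin n × Fin q => gaussianReal 0 (τ ^ 2) := by
    rw [(iIndepFun_iff_map_fun_eq_pi_map
      fun ij : Fin n × Fin q => (hE_law ij.1 ij.2).aemeasurable).1 hE_indep]
    congr 1
    ext1 ij
    exact (hE_law ij.1 ij.2).map_eq
  let bad : Fin K → Set (Fin n × Fin q → ℝ) := fun k =>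
    {z | (1 + θ) * τ * (IRRR.singularValue (IRRR.colBlock X k) 0 *
      (√(q : ℝ) + √((IRRR.colBlock X k).rank : ℝ))) <
        IRRR.singularValue ((IRRR.colBlock X k).transpose * Matrix.of fun i j => z (i, j)) 0}
  have hbad (k : Fin K) : MeasurableSet (bad k) :=
    IRRR.measurableSet_singularValue_zero_gt _
      (mul_nonneg (by positivity) (mul_nonneg (IRRR.singularValue_nonneg _ _) (by positivity)))
  have hS : MeasurableSet (⋃ k, bad k) := .iUnion hbad
  -- The noise is only almost everywhere measurable, so the good event is only null measurable. It
  -- is replaced by a measurable subset of equal probability, on which every bound still holds.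
  have hnull : NullMeasurableSet (e ⁻¹' (⋃ k, bad k)ᶜ) μ := hem.nullMeasurable hS.compl
  obtain ⟨A, hAsub, hA, hAe⟩ := hnull.exists_measurable_subset_ae_eq
  refine ⟨A, hA, ?_, fun ω hω Bhat hB C => ?_⟩
  · have h1 : μ.real A = (Measure.pi fun _ : Fin n × Fin q => gaussianReal 0 (τ ^ 2)).real
        (⋃ k, bad k)ᶜ := by
      rw [measureReal_congr hAe, ← hlaw, measureReal_def, measureReal_def,
        Measure.map_apply_of_aemeasurable hem hS.compl]
    rw [h1, probReal_compl_eq_one_sub hS]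
    refine sub_le_sub_left ((measureReal_iUnion_fintype_le bad).trans
      (Finset.sum_le_sum fun k _ => ?_)) 1
    exact IRRR.gaussian_singularValue_gt_le _ τ hθ
  · refine IRRR.oracle_inequality_of_noise_le hn X B₀ (E ω) (fun k => ?_) hB C
    have h := hAsub hω
    simp only [Set.mem_preimage, Set.mem_compl_iff, Set.mem_iUnion, not_exists] at h
    rw [hlam]
    exact not_lt.1 (h k)
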